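/- Let $\sqrt2<\lambda<2$, $T(x)=\min(\lambda x,\lambda(1-x))$, $c=\tfrac12$, $b=T(c)$, $a=T(b)$, $I=[a,b]$, and let $f=T|_I\colon I\to I$ be the core tent map. Write $\hat x=1-x$, so that $f(\hat x)=f(x)$ whenever $x,\hat x\in I$. Let $\hat I=\{\mathbf x=\langle x_0,x_1,\dots\rangle\in I^{\mathbb N}: f(x_{r+1})=x_r \text{ for all } r\ge 0\}$ be the inverse limit with the product topology, $\hat f(\langle x_0,x_1,\dots\rangle)=\langle f(x_0),x_0,x_1,\dots\rangle$ its natural extension, and $\pi_0(\mathbf x)=x_0$. *Itineraries and extreme elements.* A sequence $s\in\{0,1\}^{\mathbb N}$ is an itinerary of $\mathbf x\in\hat I$ if, for all $r\ge 0$, $x_{r+1}\le c$ when $s_r=0$ and $x_{r+1}\ge c$ when $s_r=1$. Order $\{0,1\}^{\mathbb N}$ by the unimodal order: for $s\ne t$ with first disagreement at index $r$, $s\prec t$ iff $\sum_{i=0}^r s_i$ is even. For $x\in I$ let $e(x_u)$ and $e(x_\ell)$ be the elements of $\pi_0^{-1}(x)$ which have, respectively, the largest and the smallest itinerary among all itineraries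 of elements of $\pi_0^{-1}(x)$; these are the *extreme* elements of the fiber. If $x$ is not in the post-critical set $\{f^r(c):r\ge1\}$, then every element of $\pi_0^{-1}(x)$ has a unique itinerary, and two distinct elements of $\pi_0^{-1}(x)$ are *consecutive* if no element of $\pi_0^{-1}(x)$ has its itinerary strictly between theirs. *Height.* Let $S$ be the circle obtained by gluing a lower copy $\{x_\ell\}$ and an upper copy $\{x_u\}$ of $I$ at their endpoints ($a_\ell=a_u=a$, $b_\ell=b_u=b$), oriented from $a$ to $b$ along the lower copy and back along the upper copy. The outside map $B\colon S\to S$ is given by $B(x_\ell)=f(x)_\ell$ for $x\le c$, $B(x_\ell)=f(x)_u$ for $x\ge c$, $B(x_u)=f(x)_\ell$ for $x\ge\hat a$, and $B(x_u)=f(a)_\ell$ for $x\le\hat a$. It is a continuous monotone circle map of degree one, and the height of $f$ is its Poincaré rotation number in $[0,1)$. Let $\Pi$ be the set of points of $S$ whose $B$-orbits never enter the arc $\{x_u : a<x<\hat a\}$. *The quotient.* Assume that the height is a rational number $m/n$ in lowest terms and that the orbit of $c$ is infinite (that is, $c$ is neither periodic nor pre-periodic). Put $z=f^n(a)$, and let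 $g\colon\hat I\to\Sigma$ be the quotient map (with the quotient topology on $\Sigma$) of the equivalence relation on $\hat I$ whose non-trivial classes are 1. $\{\hat f^r(e(x_u)),\hat f^r(e(\hat x_u))\}$ for $x\in(a,c)\setminus\{z,\hat z\}$ and $r\in\mathbb Z$; 2. $\{\hat f^r(e(\hat z_u)),\hat f^{r+n}(e(a)),\hat f^{r+n}(e(\hat a_u))\}$ for $r\in\mathbb Z$, where $e(a)=e(a_u)=e(a_\ell)$; 3. the set $e(\Pi)$. **Theorem.** Let $y\in I$ be a point which is not in the grand orbit of $c$, that is, $f^i(y)\ne f^j(c)$ for all $i,j\ge0$. Then: - $g(\pi_0^{-1}(y))$ is an arc in $\Sigma$, i.e. a subspace homeomorphic to $[0,1]$; - two distinct elements of $\pi_0^{-1}(y)$ have the same image under $g$ if and only if both are non-extreme and they are consecutive; - $g(e(y_u))\neq g(e(y_\ell))$. -/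

import Mathlib

open Set Topology

namespace TentSphere

/-- Slopes of the core tent maps under consideration. -/
abbrev Slope : Type := Set.Ioo (Real.sqrt 2) (2 : ℝ)

/-- The full tent map; the core tent map `f` is its restriction to `core lam`. -/
noncomputable def tent (lam : Slope) (x : ℝ) : ℝ :=
  min ((lam : ℝ) * x) ((lam : ℝ) * (1 - x))

/-- The turning point `c`. -/
noncomputable def crit : ℝ := 1 / 2

/-- The right endpoint `b = f(c)` of the core interval. -/
noncomputable def rightEnd (lam : Slope) : ℝ := tent lam crit

/-- The left endpoint `a = f²(c)` of the core interval. -/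
noncomputable def leftEnd (lam : Slope) : ℝ := tent lam (tent lam crit)

/-- The core interval `I = [a, b]`. -/
def core (lam : Slope) : Set ℝ := Set.Icc (leftEnd lam) (rightEnd lam)

/-- The involution `x ↦ x̂`; see `tent_eq_tent_iff`. -/
def hat (x : ℝ) : ℝ := 1 - x

/-- The post-critical set `PC = {fʳ(c) : r ≥ 1}`. -/
def postCritical (lam : Slope) : Set ℝ := {x | ∃ r : ℕ, 1 ≤ r ∧ (tent lam)^[r] crit = x}

/-- The grand orbit of the turning point. -/
def grandOrbit (lam : Slope) : Set ℝ :=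
  {x | x ∈ core lam ∧ ∃ m n : ℕ, (tent lam)^[m] x = (tent lam)^[n] crit}

theorem one_lt (lam : Slope) : (1 : ℝ) < lam := by
  have h1 : Real.sqrt 2 < (lam : ℝ) := lam.2.1
  have h2 : (1 : ℝ) < Real.sqrt 2 := by
    rw [Real.lt_sqrt] <;> norm_num
  linarith

theorem rightEnd_eq (lam : Slope) : rightEnd lam = (lam : ℝ) / 2 := by
  unfold rightEnd tent crit
  rw [min_eq_left] <;> linarith

theorem leftEnd_eq (lam : Slope) : leftEnd lam = (lam : ℝ) * (1 - (lam : ℝ) / 2) := by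
  have h := one_lt lam
  have hb : tent lam crit = (lam : ℝ) / 2 := rightEnd_eq lam
  unfold leftEnd
  rw [hb]
  unfold tent
  apply min_eq_right
  nlinarith

/-- For `x ≠ c`, the point `x̂` is the unique other point with the same image as `x`. -/
theorem tent_eq_tent_iff (lam : Slope) (x y : ℝ) :
    tent lam x = tent lam y ↔ y = x ∨ y = hat x := by
  have h := one_lt lam
  have key : ∀ t : ℝ, tent lam t = (lam : ℝ) * min t (1 - t) := fun t => by
    unfold tent
    exact (mul_min_of_nonneg _ _ (by linarith)).symm
  rw [key, key, mul_right_inj' (by linarith)]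
  unfold hat
  constructor
  · intro e
    rcases min_cases x (1 - x) with ⟨h1, h2⟩ | ⟨h1, h2⟩ <;>
      rcases min_cases y (1 - y) with ⟨h3, h4⟩ | ⟨h3, h4⟩ <;> rw [h1, h3] at e
    · left; linarith
    · right; linarith
    · right; linarith
    · left; linarith
  · rintro (rfl | rfl)
    · rfl
    · rw [min_comm]; congr 1; ring

theorem tent_mem_core (lam : Slope) {x : ℝ} (hx : x ∈ core lam) : tent lam x ∈ core lam := by
  have h := one_lt lam
  have h2 : (lam : ℝ) < 2 := lam.2.2
  obtain ⟨h3, h4⟩ := hx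
  have ha := leftEnd_eq lam
  have hb := rightEnd_eq lam
  have ha0 : 0 ≤ leftEnd lam := by rw [ha]; nlinarith
  constructor
  · unfold tent
    apply le_min
    · nlinarith
    · rw [ha]; rw [hb] at h4; nlinarith
  · rw [hb]
    unfold tent
    rcases le_total x (1 / 2) with hx | hx
    · exact (min_le_left _ _).trans (by nlinarith)
    · exact (min_le_right _ _).trans (by nlinarith)

/-! ### The inverse limit -/

/-- The inverse limit `Î` of the core tent map, a subspace of a countable product of lines. -/
def InvLim (lam : Slope) : Type :=
  {x : ℕ → ℝ // (∀ r, x r ∈ core lam) ∧ ∀ r, tent lam (x (r + 1)) = x r}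

instance (lam : Slope) : TopologicalSpace (InvLim lam) :=
  inferInstanceAs (TopologicalSpace
    {x : ℕ → ℝ // (∀ r, x r ∈ core lam) ∧ ∀ r, tent lam (x (r + 1)) = x r})

/-- The projection `π_r` to the `r`-th coordinate. -/
def proj {lam : Slope} (r : ℕ) (p : InvLim lam) : ℝ := p.1 r

/-- The fiber of `π₀` above `x`. -/
def fiber (lam : Slope) (x : ℝ) : Set (InvLim lam) := {p | proj 0 p = x}

/-- The natural extension `⟨x₀, x₁, …⟩ ↦ ⟨f(x₀), x₀, x₁, …⟩`. -/
noncomputable def natExt (lam : Slope) : Equiv.Perm (InvLim lam) where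
  toFun p := ⟨fun r => Nat.casesOn r (tent lam (p.1 0)) (fun k => p.1 k), by
    constructor
    · rintro (_ | r)
      · exact tent_mem_core lam (p.2.1 0)
      · exact p.2.1 r
    · rintro (_ | r)
      · rfl
      · exact p.2.2 r⟩
  invFun p := ⟨fun r => p.1 (r + 1), fun r => p.2.1 (r + 1), fun r => p.2.2 (r + 1)⟩
  left_inv p := by
    apply Subtype.ext
    funext r
    rfl
  right_inv p := by
    apply Subtype.ext
    funext r
    cases r with
    | zero => exact p.2.2 0
    | succ r => rfl

/-! ### Itineraries, extreme and consecutive elements of fibers -/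

/-- The strict unimodal (parity-lexicographical) order on `{0,1}^ℕ`. -/
def UniLT (s t : ℕ → Fin 2) : Prop :=
  ∃ r : ℕ, (∀ i < r, s i = t i) ∧ s r ≠ t r ∧
    Even (∑ i ∈ Finset.range (r + 1), (s i : ℕ))

/-- The unimodal order on `{0,1}^ℕ`. -/
def UniLE (s t : ℕ → Fin 2) : Prop := s = t ∨ UniLT s t

/-- `s` is an itinerary of the point `p` of the inverse limit. -/
def IsItin {lam : Slope} (p : InvLim lam) (s : ℕ → Fin 2) : Prop :=
  ∀ r : ℕ, (s r = 0 → proj (r + 1) p ≤ crit) ∧ (s r = 1 → crit ≤ proj (r + 1) p)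

/-- The set of all itineraries realized in the fiber above `x`. -/
def fiberItins (lam : Slope) (x : ℝ) : Set (ℕ → Fin 2) := {s | ∃ p ∈ fiber lam x, IsItin p s}

/-- The two sides, lower and upper. -/
inductive Side : Type
  | lower : Side
  | upper : Side

/-- `IsExtremeElt .upper x p` says that `p = e(x_u)`: it is the element of the fiber above `x` which
has the maximum itinerary of that fiber. Likewise `IsExtremeElt .lower x p` says that `p = e(x_ℓ)`,
with the minimum itinerary. -/
def IsExtremeElt {lam : Slope} : Side → ℝ → InvLim lam → Prop
  | .lower, x, p => p ∈ fiber lam x ∧ ∃ s, IsItin p s ∧ ∀ t ∈ fiberItins lam x, UniLE s t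
  | .upper, x, p => p ∈ fiber lam x ∧ ∃ s, IsItin p s ∧ ∀ t ∈ fiberItins lam x, UniLE t s

/-- Consecutive elements of the fiber above `x`, for `x` outside the post-critical set (so that
every element of the fiber has a unique itinerary). -/
def Consecutive {lam : Slope} (x : ℝ) (p p' : InvLim lam) : Prop :=
  p ∈ fiber lam x ∧ p' ∈ fiber lam x ∧ p ≠ p' ∧
    ∀ s s' : ℕ → Fin 2, IsItin p s → IsItin p' s' →
      ∀ t ∈ fiberItins lam x, ¬ (UniLT s t ∧ UniLT t s') ∧ ¬ (UniLT s' t ∧ UniLT t s)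

/-! ### The outside map and the height -/

/-- The outside map `B` of the circle `S` obtained by gluing a lower and an upper copy of `I` at
their endpoints. The pair `(side, x)` with `x ∈ I` stands for the point `x_ℓ` or `x_u`. -/
noncomputable def outsideMap (lam : Slope) : Side × ℝ → Side × ℝ
  | (.lower, x) => if x ≤ crit then (.lower, tent lam x) else (.upper, tent lam x)
  | (.upper, x) => if hat (leftEnd lam) < x then (.lower, tent lam x)
      else (.lower, tent lam (leftEnd lam))

/-- The parametrization of the circle `S` by `[0, 1]`: the lower copy of `I` is traversed from `a`
to `b`, then the upper copy from `b` to `a`. -/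
noncomputable def circleCoord (lam : Slope) : Side × ℝ → ℝ
  | (.lower, x) => (x - leftEnd lam) / (2 * (rightEnd lam - leftEnd lam))
  | (.upper, x) => 1 - (x - leftEnd lam) / (2 * (rightEnd lam - leftEnd lam))

/-- `F` is a lift of the outside map to the universal cover of the circle. -/
def IsOutsideLift (lam : Slope) (F : CircleDeg1Lift) : Prop :=
  Continuous F ∧ ∀ (side : Side), ∀ x ∈ core lam,
    ((F (circleCoord lam (side, x)) : ℝ) : UnitAddCircle) =
      ((circleCoord lam (outsideMap lam (side, x)) : ℝ) : UnitAddCircle)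

/-- The outside map has a lift, so that its rotation number is meaningful. -/
theorem exists_outsideLift (lam : Slope) : ∃ F : CircleDeg1Lift, IsOutsideLift lam F := by
  have h1 := one_lt lam
  have h2 : (lam : ℝ) < 2 := lam.2.2
  have ha := leftEnd_eq lam
  have hb := rightEnd_eq lam
  set l : ℝ := (lam : ℝ) with hl
  set k : ℝ := (l - 1) * leftEnd lam / (2 * (rightEnd lam - leftEnd lam)) with hk
  have hL : 0 < rightEnd lam - leftEnd lam := by rw [ha, hb]; nlinarith
  have ha0 : 0 < leftEnd lam := by rw [ha]; nlinarith
  have hac : leftEnd lam < 1 / 2 := by rw [ha]; nlinarith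
  let F : CircleDeg1Lift :=
    { toFun := fun t => ⌊t⌋ + k + min (l * Int.fract t) 1
      monotone' := by
        intro s t hst
        change (⌊s⌋ : ℝ) + k + min (l * Int.fract s) 1 ≤ ⌊t⌋ + k + min (l * Int.fract t) 1
        rcases (Int.floor_mono hst).eq_or_lt with e | e
        · have hf : Int.fract s ≤ Int.fract t := by
            unfold Int.fract; rw [e]; linarith
          rw [e]
          gcongr
        · have e' : (⌊s⌋ : ℝ) + 1 ≤ ⌊t⌋ := by exact_mod_cast e
          have h3 : min (l * Int.fract s) 1 ≤ 1 := min_le_right _ _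
          have h4 : 0 ≤ min (l * Int.fract t) 1 :=
            le_min (mul_nonneg (by linarith) (Int.fract_nonneg t)) zero_le_one
          linarith
      map_add_one' := fun t => by
        rw [Int.floor_add_one, Int.fract_add_one]; push_cast; ring }
  have hF : ∀ t, F t = ⌊t⌋ + k + min (l * Int.fract t) 1 := fun t => rfl
  -- on `[0, 1]` the lift has a uniform formula
  have hF' : ∀ t, 0 ≤ t → t ≤ 1 → F t = k + min (l * t) 1 := by
    intro t h3 h4
    rw [hF]
    rcases h4.lt_or_eq with h4 | rfl
    · rw [Int.floor_eq_zero_iff.2 ⟨h3, h4⟩, Int.fract_eq_self.2 ⟨h3, h4⟩]; simp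
    · rw [Int.floor_one, Int.fract_one, mul_one, min_eq_right h1.le]; simp; ring
  refine ⟨F, ?_, ?_⟩
  · have hc : Continuous ((fun u : ℝ => min (l * u) 1 - u) ∘ Int.fract) :=
      ContinuousOn.comp_fract'' (by fun_prop) (by simp [h1.le])
    have hFe : (F : ℝ → ℝ) = fun t => t + k + ((fun u : ℝ => min (l * u) 1 - u) ∘ Int.fract) t := by
      funext t
      rw [hF]
      simp only [Function.comp]
      linarith [Int.floor_add_fract t]
    rw [hFe]
    fun_prop
  · intro side x hx
    obtain ⟨hx1, hx2⟩ := hx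
    have hx3 : 0 ≤ (x - leftEnd lam) / (2 * (rightEnd lam - leftEnd lam)) :=
      div_nonneg (by linarith) (by linarith)
    have hx4 : (x - leftEnd lam) / (2 * (rightEnd lam - leftEnd lam)) ≤ 1 / 2 := by
      rw [div_le_iff₀ (by linarith)]; linarith
    have hL2 : 2 * (rightEnd lam - leftEnd lam) = l * (1 - 2 * (1 - l / 2)) := by
      rw [ha, hb]; ring
    have hL3 : l * (1 - 2 * (1 - l / 2)) = l * (l - 1) := by ring
    have hne : l ≠ 0 := by linarith
    have hne' : l - 1 ≠ 0 := by linarith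
    cases side with
    | lower =>
      simp only [circleCoord, outsideMap]
      rw [hF' _ hx3 (hx4.trans (by norm_num))]
      have hmin : min (l * ((x - leftEnd lam) / (2 * (rightEnd lam - leftEnd lam)))) 1 =
          l * ((x - leftEnd lam) / (2 * (rightEnd lam - leftEnd lam))) := by
        apply min_eq_left; nlinarith
      rw [hmin]
      split_ifs with hxc
      · have ht : tent lam x = l * x := by
          unfold tent crit at *; apply min_eq_left; nlinarith
        rw [ht]
        congr 1
        simp only [hk]
        rw [hL2, hL3]
        field_simp
        ring
      · have ht : tent lam x = l * (1 - x) := by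
          unfold tent crit at *; apply min_eq_right; push Not at hxc; nlinarith
        rw [ht]
        congr 1
        simp only [hk]
        rw [hL2, hL3, ha]
        field_simp
        ring
    | upper =>
      have hone : ∀ t : ℝ, ((t + 1 : ℝ) : UnitAddCircle) = (t : UnitAddCircle) := fun t => by
        rw [AddCircle.coe_add, AddCircle.coe_period, add_zero]
      have hd : ∀ w, (w - leftEnd lam) / (2 * (rightEnd lam - leftEnd lam)) =
          (w - leftEnd lam) / (l * (l - 1)) := fun w => by rw [hL2, hL3]
      have hll : 0 < l * (l - 1) := by nlinarith
      simp only [circleCoord, outsideMap]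
      rw [hF' _ (by linarith) (by linarith), hd]
      split_ifs with hxc
      · have ht : tent lam x = l * (1 - x) := by
          unfold tent hat at *; apply min_eq_right; nlinarith
        have hle : 1 - 1 / l ≤ (x - leftEnd lam) / (l * (l - 1)) := by
          rw [le_div_iff₀ hll]
          have : (1 - 1 / l) * (l * (l - 1)) = (l - 1) ^ 2 := by field_simp
          rw [this]
          unfold hat at hxc
          nlinarith
        have hmin : min (l * (1 - (x - leftEnd lam) / (l * (l - 1)))) 1 =
            l * (1 - (x - leftEnd lam) / (l * (l - 1))) := by
          apply min_eq_left
          have : l * (1 / l) = 1 := by field_simp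
          nlinarith
        rw [hmin, ht]
        dsimp only
        refine Eq.trans ?_ (hone _)
        congr 1
        rw [hk, hd, hL2, hL3, ha]
        field_simp
        ring
      · have ht : tent lam (leftEnd lam) = l * leftEnd lam := by
          unfold tent; apply min_eq_left; nlinarith
        have hle : (x - leftEnd lam) / (l * (l - 1)) ≤ 1 - 1 / l := by
          rw [div_le_iff₀ hll]
          have : (1 - 1 / l) * (l * (l - 1)) = (l - 1) ^ 2 := by field_simp
          rw [this]
          unfold hat at hxc
          push Not at hxc
          nlinarith
        have hmin : min (l * (1 - (x - leftEnd lam) / (l * (l - 1)))) 1 = 1 := by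
          apply min_eq_right
          have : l * (1 / l) = 1 := by field_simp
          nlinarith
        rw [hmin, ht, hone]
        congr 1
        rw [hk]
        ring

/-- The height of the tent map, that is, the Poincaré rotation number in `[0, 1)` of the outside
map, is `q`. -/
def HasHeight (lam : Slope) (q : ℝ) : Prop :=
  q ∈ Set.Ico (0 : ℝ) 1 ∧
    ∃ F : CircleDeg1Lift, IsOutsideLift lam F ∧
      ((F.translationNumber : ℝ) : UnitAddCircle) = ((q : ℝ) : UnitAddCircle)

/-- The open arc `(â_u, a)` of the circle `S`. -/
def gap (lam : Slope) : Set (Side × ℝ) :=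
  {w | w.1 = .upper ∧ w.2 ∈ Set.Ioo (leftEnd lam) (hat (leftEnd lam))}

/-- The set `Π` of points of the circle whose orbits under the outside map never enter `gap`. -/
def neverGap (lam : Slope) : Set (Side × ℝ) :=
  {w | w.2 ∈ core lam ∧ ∀ r : ℕ, (outsideMap lam)^[r] w ∉ gap lam}

/-- The set `e(Π)` of the corresponding extreme elements. -/
def specialOrbit (lam : Slope) : Set (InvLim lam) :=
  {p | ∃ w ∈ neverGap lam, IsExtremeElt w.1 w.2 p}

/-! ### The quotient map `g : Î → Σ`, for height `m/n` in lowest terms -/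

/-- The point `z = fⁿ(a)`. -/
noncomputable def zPt (lam : Slope) (n : ℕ) : ℝ := (tent lam)^[n] (leftEnd lam)

/-- The class `{f̂ʳ(e(x_u)), f̂ʳ(e(x̂_u))}`. -/
def classI (lam : Slope) (x : ℝ) (r : ℤ) : Set (InvLim lam) :=
  {p | ∃ u, (IsExtremeElt .upper x u ∨ IsExtremeElt .upper (hat x) u) ∧ p = (natExt lam ^ r) u}

/-- The class `{f̂ʳ(e(ẑ_u)), f̂ʳ⁺ⁿ(e(a)), f̂ʳ⁺ⁿ(e(â_u))}`. -/
def classII (lam : Slope) (n : ℕ) (r : ℤ) : Set (InvLim lam) :=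
  {p | (∃ u, IsExtremeElt .upper (hat (zPt lam n)) u ∧ p = (natExt lam ^ r) u) ∨
    ∃ u, (IsExtremeElt .upper (leftEnd lam) u ∨ IsExtremeElt .upper (hat (leftEnd lam)) u) ∧
      p = (natExt lam ^ (r + (n : ℤ))) u}

/-- The collection of the non-trivial equivalence classes. -/
def identClasses (lam : Slope) (n : ℕ) : Set (Set (InvLim lam)) :=
  {C | (∃ x ∈ Set.Ioo (leftEnd lam) crit, x ≠ zPt lam n ∧ x ≠ hat (zPt lam n) ∧
        ∃ r : ℤ, C = classI lam x r) ∨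
      (∃ r : ℤ, C = classII lam n r) ∨ C = specialOrbit lam}

/-- The equivalence relation whose non-trivial classes are the members of `identClasses`, defined
as the smallest equivalence relation which collapses each of them (these classes are pairwise
disjoint when the height is `m/n` in lowest terms and the critical orbit is infinite). -/
def identSetoid (lam : Slope) (n : ℕ) : Setoid (InvLim lam) :=
  Relation.EqvGen.setoid fun p p' => ∃ C ∈ identClasses lam n, p ∈ C ∧ p' ∈ C

/-- The quotient space `Σ`, with the quotient topology. -/
def Sig (lam : Slope) (n : ℕ) : Type := Quotient (identSetoid lam n)

instance (lam : Slope) (n : ℕ) : TopologicalSpace (Sig lam n) :=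
  inferInstanceAs (TopologicalSpace (Quotient (identSetoid lam n)))

/-- The quotient map `g : Î → Σ`. -/
def gMap (lam : Slope) (n : ℕ) : InvLim lam → Sig lam n := Quotient.mk (identSetoid lam n)

/-- An arc: a subspace homeomorphic to the closed unit interval. -/
def IsArc {X : Type*} [TopologicalSpace X] (A : Set X) : Prop := Nonempty (unitInterval ≃ₜ A)

end TentSphere

open TentSphere

namespace TentSphere

variable {lam : Slope}

/-! ### Elementary facts on the tent map -/

/-! Give every fiber of `π₀` mass 1 and split the mass evenly each time a point has two preimages in
`I`. The distribution function of this measure in the unimodal order is `level`. Along a backward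
orbit it obeys an affine recursion: `t ↦ 1 - t` when `x₀ < f(a)` (only the right preimage lies in
`I`), otherwise `t ↦ t / 2` or `t ↦ 1 - t / 2` for the left or right preimage. Because `f(a) < â`,
which follows from `λ² > 2`, two steps of slope `-1` never follow each other, so the recursion
contracts and determines `level`.

Call a point generic if its coordinates avoid the grand orbit of `c`. On a generic fiber `level` is
monotone in the itinerary (`level_mono`), continuous (`continuousOn_level`) and onto `[0, 1]`
(`exists_level_eq`). The values 0 and 1 are taken only at the extreme elements (`isExtremeElt_iff`).
Every other value is taken at most twice, and two points share it exactly when they are consecutive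
(`consecutive_iff`).

If two points of a fiber share a level and first differ at coordinate `k + 1`, those coordinates are
exchanged by the involution and both tails there have level 1 (`level_eq_aux`). The two points are
therefore the images under `f̂ᵏ⁺¹` of `e(x_u)` and `e(x̂_u)`, a class of type 1. Conversely, a
generic class of type 1 with `r > 0` lies in one fiber at one level, and with `r ≤ 0` it joins
extreme elements of different fibers (`Folded.cases`). Classes of type 2 contain no generic point.

There remains `e(Π)`. The outside map expands off the gap, so with rational rotation number every
orbit in `Π` is eventually periodic (`exists_iterate_eq`). As the critical orbit is infinite, `e(Π)`
is then generic; it is also finite, and it meets a generic fiber at most once. Hence on a generic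
fiber `g` identifies points exactly when their levels agree (`gMap_eq_iff`). This gives the second
and third claims and a bijection from `[0, 1]` to the image of the fiber. It is a homeomorphism
because saturating a closed part of the fiber adds only finitely many points
(`isClosed_saturation`). -/

theorem slope_lt_two (lam : Slope) : (lam : ℝ) < 2 := lam.2.2

theorem two_lt_slope_sq (lam : Slope) : (2 : ℝ) < (lam : ℝ) ^ 2 := by
  have h1 : Real.sqrt 2 < (lam : ℝ) := lam.2.1
  exact (Real.sqrt_lt' (by linarith [one_lt lam])).1 h1

theorem leftEnd_lt_crit (lam : Slope) : leftEnd lam < crit := by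
  rw [leftEnd_eq, crit]; nlinarith [one_lt lam, slope_lt_two lam]

theorem crit_lt_rightEnd (lam : Slope) : crit < rightEnd lam := by
  rw [rightEnd_eq, crit]; linarith [one_lt lam]

theorem crit_mem_core (lam : Slope) : crit ∈ core lam :=
  ⟨(leftEnd_lt_crit lam).le, (crit_lt_rightEnd lam).le⟩

theorem leftEnd_mem_core (lam : Slope) : leftEnd lam ∈ core lam :=
  ⟨le_rfl, ((leftEnd_lt_crit lam).trans (crit_lt_rightEnd lam)).le⟩

theorem hat_hat (x : ℝ) : hat (hat x) = x := by unfold hat; ring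

theorem crit_lt_hat_leftEnd (lam : Slope) : crit < hat (leftEnd lam) := by
  have := leftEnd_lt_crit lam
  unfold crit hat at *; linarith

theorem hat_leftEnd_mem_core (lam : Slope) : hat (leftEnd lam) ∈ core lam := by
  refine ⟨((leftEnd_lt_crit lam).trans (crit_lt_hat_leftEnd lam)).le, ?_⟩
  unfold hat
  rw [leftEnd_eq, rightEnd_eq]; nlinarith [one_lt lam, slope_lt_two lam]

theorem tent_of_le {x : ℝ} (h : x ≤ crit) : tent lam x = lam * x := by
  unfold tent crit at *; apply min_eq_left; nlinarith [one_lt lam]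

theorem tent_of_ge {x : ℝ} (h : crit ≤ x) : tent lam x = lam * (1 - x) := by
  unfold tent crit at *; apply min_eq_right; nlinarith [one_lt lam]

theorem tent_hat (x : ℝ) : tent lam (hat x) = tent lam x :=
  ((tent_eq_tent_iff lam x (hat x)).2 (Or.inr rfl)).symm

theorem tent_leftEnd (lam : Slope) : tent lam (leftEnd lam) = lam * leftEnd lam :=
  tent_of_le (leftEnd_lt_crit lam).le

/-- The inequality amounts to `(λ - 1)(λ² - 2) > 0`. -/
theorem tent_leftEnd_lt (lam : Slope) : tent lam (leftEnd lam) < hat (leftEnd lam) := by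
  have h1 := one_lt lam
  have h2 := two_lt_slope_sq lam
  rw [tent_leftEnd]; unfold hat; rw [leftEnd_eq]
  nlinarith [mul_pos (sub_pos.2 h1) (sub_pos.2 h2)]

theorem tent_lt_of_hat_lt {x : ℝ} (h : hat (leftEnd lam) < x) :
    tent lam x < tent lam (leftEnd lam) := by
  have h1 := one_lt lam
  rw [tent_of_ge ((crit_lt_hat_leftEnd lam).trans h).le, tent_leftEnd]
  unfold hat at h; nlinarith

/-! ### The grand orbit of the turning point -/

theorem tent_mem_grandOrbit_iff {x : ℝ} (hx : x ∈ core lam) :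
    tent lam x ∈ grandOrbit lam ↔ x ∈ grandOrbit lam := by
  constructor
  · rintro ⟨-, m, n, h⟩
    exact ⟨hx, m + 1, n, h⟩
  · rintro ⟨-, m, n, h⟩
    refine ⟨tent_mem_core lam hx, m, n + 1, ?_⟩
    rw [← Function.iterate_succ_apply, Function.iterate_succ_apply', h,
      Function.iterate_succ_apply']

theorem crit_mem_grandOrbit (lam : Slope) : crit ∈ grandOrbit lam :=
  ⟨crit_mem_core lam, 0, 0, rfl⟩

theorem iterate_mem_grandOrbit_iff {x : ℝ} (hx : x ∈ core lam) (n : ℕ) :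
    (tent lam)^[n] x ∈ grandOrbit lam ↔ x ∈ grandOrbit lam := by
  induction n generalizing x with
  | zero => rfl
  | succ n ih => exact (ih (tent_mem_core lam hx)).trans (tent_mem_grandOrbit_iff hx)

theorem leftEnd_mem_grandOrbit (lam : Slope) : leftEnd lam ∈ grandOrbit lam :=
  (iterate_mem_grandOrbit_iff (crit_mem_core lam) 2).2 (crit_mem_grandOrbit lam)

theorem rightEnd_mem_grandOrbit (lam : Slope) : rightEnd lam ∈ grandOrbit lam :=
  (iterate_mem_grandOrbit_iff (crit_mem_core lam) 1).2 (crit_mem_grandOrbit lam)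

theorem hat_mem_grandOrbit {x : ℝ} (hx : hat x ∈ core lam) (h : x ∈ grandOrbit lam) :
    hat x ∈ grandOrbit lam := by
  rw [← tent_mem_grandOrbit_iff hx, tent_hat]
  exact (tent_mem_grandOrbit_iff h.1).2 h

theorem hat_mem_grandOrbit_iff {x : ℝ} (hx : x ∈ core lam) (hx' : hat x ∈ core lam) :
    hat x ∈ grandOrbit lam ↔ x ∈ grandOrbit lam :=
  ⟨fun h => by simpa [hat_hat] using hat_mem_grandOrbit (x := hat x) (by rwa [hat_hat]) h,
    hat_mem_grandOrbit hx'⟩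

/-- No point of the grand orbit is eventually periodic when the critical orbit is infinite. -/
theorem notMem_grandOrbit_of_eventually_periodic (hinf : (postCritical lam).Infinite) {x : ℝ}
    {i j : ℕ} (hij : i < j) (h : (tent lam)^[i] x = (tent lam)^[j] x) : x ∉ grandOrbit lam := by
  rintro ⟨-, m, n, hmn⟩
  obtain ⟨d, rfl⟩ := Nat.exists_eq_add_of_lt hij
  -- From `fᵐ(x) = fⁿ(c)`, the point `f^(i+n+k)(c)` equals `f^(m+k)(fⁱ(x))`, so from index `i + n`
  -- on the orbit of `c` has period `d + 1`.
  set N := i + n with hN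
  have key : ∀ k, (tent lam)^[N + (d + 1) + k] crit = (tent lam)^[N + k] crit := by
    intro k
    have e1 : (tent lam)^[N + (d + 1) + k] crit = (tent lam)^[m + k] ((tent lam)^[i + d + 1] x) := by
      rw [show N + (d + 1) + k = (i + d + 1 + k) + n by omega, Function.iterate_add_apply, ← hmn,
        ← Function.iterate_add_apply, ← Function.iterate_add_apply]
      congr 1; omega
    have e2 : (tent lam)^[N + k] crit = (tent lam)^[m + k] ((tent lam)^[i] x) := by
      rw [show N + k = (i + k) + n by omega, Function.iterate_add_apply, ← hmn,
        ← Function.iterate_add_apply, ← Function.iterate_add_apply]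
      congr 1; omega
    rw [e1, e2, h]
  apply hinf
  refine ((Set.finite_lt_nat (N + (d + 1))).image fun r => (tent lam)^[r] crit).subset ?_
  rintro _ ⟨r, -, rfl⟩
  induction r using Nat.strong_induction_on with
  | _ r ih =>
    by_cases hr : r < N + (d + 1)
    · exact ⟨r, hr, rfl⟩
    · have e := key (r - (N + (d + 1)))
      rw [show N + (d + 1) + (r - (N + (d + 1))) = r by omega] at e
      rw [e]
      exact ih _ (by omega)

/-! ### The shift on the inverse limit -/

/-- The inverse of the natural extension. -/
noncomputable def shift (p : InvLim lam) : InvLim lam := (natExt lam).symm p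

theorem shift_val (p : InvLim lam) (r : ℕ) : (shift p).1 r = p.1 (r + 1) := rfl

theorem shift_natExt (p : InvLim lam) : shift (natExt lam p) = p := (natExt lam).symm_apply_apply p

theorem natExt_shift (p : InvLim lam) : natExt lam (shift p) = p := (natExt lam).apply_symm_apply p

theorem natExt_val_zero (p : InvLim lam) : (natExt lam p).1 0 = tent lam (p.1 0) := rfl

theorem natExt_val_succ (p : InvLim lam) (r : ℕ) : (natExt lam p).1 (r + 1) = p.1 r := rfl

theorem iterate_shift_val (p : InvLim lam) (k r : ℕ) : (shift^[k] p).1 r = p.1 (r + k) := by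
  induction k generalizing r with
  | zero => rfl
  | succ k ih => rw [Function.iterate_succ_apply', shift_val, ih, show r + 1 + k = r + (k + 1) by omega]

theorem iterate_natExt_val_zero (p : InvLim lam) (k : ℕ) :
    ((natExt lam)^[k] p).1 0 = (tent lam)^[k] (p.1 0) := by
  induction k with
  | zero => rfl
  | succ k ih => rw [Function.iterate_succ_apply', natExt_val_zero, ih,
      Function.iterate_succ_apply']

theorem val_ext {p p' : InvLim lam} (h : ∀ r, p.1 r = p'.1 r) : p = p' :=
  Subtype.ext (funext h)

theorem zpow_natExt_ofNat (k : ℕ) (p : InvLim lam) :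
    (natExt lam ^ (k : ℤ)) p = (natExt lam)^[k] p := by
  rw [zpow_natCast, Equiv.Perm.iterate_eq_pow]

theorem zpow_natExt_neg_ofNat (k : ℕ) (p : InvLim lam) :
    (natExt lam ^ (-(k : ℤ))) p = shift^[k] p := by
  rw [zpow_neg, zpow_natCast, ← inv_pow, ← Equiv.Perm.iterate_eq_pow]
  rfl

theorem iterate_natExt_shift (k : ℕ) (p : InvLim lam) : (natExt lam)^[k] (shift^[k] p) = p :=
  (Function.LeftInverse.iterate (g := natExt lam) (f := shift) natExt_shift k) p

/-- The points of the inverse limit whose coordinates avoid the grand orbit of `c`. -/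
def Generic (p : InvLim lam) : Prop := p.1 0 ∉ grandOrbit lam

theorem generic_shift {p : InvLim lam} : Generic (shift p) ↔ Generic p := by
  unfold Generic
  rw [shift_val, ← tent_mem_grandOrbit_iff (p.2.1 _), p.2.2]

theorem generic_iterate_shift {p : InvLim lam} (k : ℕ) : Generic (shift^[k] p) ↔ Generic p := by
  induction k with
  | zero => rfl
  | succ k ih => rw [Function.iterate_succ_apply', generic_shift, ih]

theorem generic_zpow {p : InvLim lam} (r : ℤ) : Generic ((natExt lam ^ r) p) ↔ Generic p := by
  obtain ⟨k, rfl | rfl⟩ := r.eq_nat_or_neg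
  · rw [← generic_iterate_shift k, zpow_natExt_ofNat,
      (Function.LeftInverse.iterate (g := shift) (f := natExt lam) shift_natExt k) p]
  · rw [zpow_natExt_neg_ofNat, generic_iterate_shift]

theorem Generic.val_notMem {p : InvLim lam} (hp : Generic p) (k : ℕ) : p.1 k ∉ grandOrbit lam := by
  have := (generic_iterate_shift k).2 hp
  unfold Generic at this
  rwa [iterate_shift_val, zero_add] at this

theorem Generic.val_ne_crit {p : InvLim lam} (hp : Generic p) (k : ℕ) : p.1 k ≠ crit :=
  fun h => hp.val_notMem k (h ▸ crit_mem_grandOrbit lam)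

theorem Generic.leftEnd_lt {p : InvLim lam} (hp : Generic p) (k : ℕ) : leftEnd lam < p.1 k :=
  lt_of_le_of_ne (p.2.1 k).1 fun h => hp.val_notMem k (h ▸ leftEnd_mem_grandOrbit lam)

theorem Generic.ne_hat_leftEnd {p : InvLim lam} (hp : Generic p) (k : ℕ) :
    p.1 k ≠ hat (leftEnd lam) := fun h => hp.val_notMem k
  (h ▸ hat_mem_grandOrbit (hat_leftEnd_mem_core lam) (leftEnd_mem_grandOrbit lam))

/-! ### The height function of the fibers -/

/-- The constant part of the affine recursion for `level`. -/
noncomputable def levelOffset (p : InvLim lam) : ℝ :=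
  if p.1 0 < tent lam (leftEnd lam) then 1 else if p.1 1 ≤ crit then 0 else 1

/-- The linear part of the affine recursion for `level`. -/
noncomputable def levelSlope (p : InvLim lam) : ℝ :=
  if p.1 0 < tent lam (leftEnd lam) then -1 else if p.1 1 ≤ crit then 1 / 2 else -(1 / 2)

/-- The terms of the series defining `level`. -/
noncomputable def levelTerm : ℕ → InvLim lam → ℝ
  | 0, p => levelOffset p
  | r + 1, p => levelSlope p * levelTerm r (shift p)

/-- The distribution function, on each fiber of `π₀`, of the measure which splits evenly at each
point with two preimages. -/
noncomputable def level (p : InvLim lam) : ℝ := ∑' r, levelTerm r p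

theorem abs_levelOffset_le (p : InvLim lam) : |levelOffset p| ≤ 1 := by
  unfold levelOffset; split_ifs <;> simp

theorem abs_levelSlope_le (p : InvLim lam) : |levelSlope p| ≤ 1 := by
  unfold levelSlope; split_ifs <;> norm_num [abs_of_pos]

/-- The left preimage of such a point would lie below `a`, outside the core. The right one is its
mirror image, hence above `â`. -/
theorem hat_lt_of_lt_tent_leftEnd {p : InvLim lam} (h : p.1 0 < tent lam (leftEnd lam)) :
    hat (leftEnd lam) < p.1 1 := by
  have h1 := one_lt lam
  have e : tent lam (p.1 1) = p.1 0 := p.2.2 0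
  rcases le_total (p.1 1) crit with hc | hc
  · rw [tent_of_le hc] at e
    rw [tent_leftEnd] at h
    have := (p.2.1 1).1
    nlinarith
  · rw [tent_of_ge hc] at e
    rw [tent_leftEnd] at h
    unfold hat
    nlinarith

/-- A slope of modulus 1 requires `x₀ < f(a)`, and then `x₁ > â > f(a)`, so the next slope has
modulus `1 / 2`. -/
theorem abs_levelSlope_mul_le (p : InvLim lam) : |levelSlope p * levelSlope (shift p)| ≤ 1 / 2 := by
  have h0 := abs_levelSlope_le p
  have h1 := abs_levelSlope_le (shift p)
  rw [abs_mul]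
  by_cases h : p.1 0 < tent lam (leftEnd lam)
  · have h2 : ¬ (shift p).1 0 < tent lam (leftEnd lam) :=
      not_lt.2 ((tent_leftEnd_lt lam).trans (hat_lt_of_lt_tent_leftEnd h)).le
    have : |levelSlope (shift p)| = 1 / 2 := by
      unfold levelSlope; rw [if_neg h2]; split_ifs <;> norm_num [abs_of_pos]
    rw [this]; linarith
  · have : |levelSlope p| = 1 / 2 := by
      unfold levelSlope; rw [if_neg h]; split_ifs <;> norm_num [abs_of_pos]
    rw [this]; linarith

/-- Two steps contract by `1 / 2`, which is less than `(3 / 4) ^ 2`; the factor 2 absorbs a leftover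
single step. -/
theorem abs_levelTerm_le : ∀ (r : ℕ) (p : InvLim lam), |levelTerm r p| ≤ 2 * (3 / 4) ^ r
  | 0, p => by
    have := abs_levelOffset_le p
    simp only [levelTerm, pow_zero]; linarith
  | 1, p => by
    have h1 := abs_levelOffset_le (shift p)
    have h2 := abs_levelSlope_le p
    simp only [levelTerm, abs_mul, pow_one]
    nlinarith [abs_nonneg (levelOffset (shift p)), abs_nonneg (levelSlope p)]
  | r + 2, p => by
    have h1 := abs_levelTerm_le r (shift (shift p))
    have h2 := abs_levelSlope_mul_le p
    simp only [levelTerm]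
    rw [← mul_assoc, abs_mul, pow_add]
    have h3 : (0 : ℝ) < 2 * (3 / 4) ^ r := by positivity
    nlinarith [abs_nonneg (levelTerm r (shift (shift p))),
      abs_nonneg (levelSlope p * levelSlope (shift p))]

theorem summable_levelTerm (p : InvLim lam) : Summable fun r => levelTerm r p :=
  Summable.of_norm_bounded
    ((summable_geometric_of_lt_one (by norm_num) (by norm_num : (3 / 4 : ℝ) < 1)).mul_left 2)
    fun r => abs_levelTerm_le r p

theorem level_eq (p : InvLim lam) : level p = levelOffset p + levelSlope p * level (shift p) := by
  unfold level
  rw [(summable_levelTerm p).tsum_eq_zero_add, ← tsum_mul_left]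
  rfl

theorem affine_mem_Icc (p : InvLim lam) {t : ℝ} (ht : t ∈ Icc (0 : ℝ) 1) :
    levelOffset p + levelSlope p * t ∈ Icc (0 : ℝ) 1 := by
  obtain ⟨h0, h1⟩ := ht
  unfold levelOffset levelSlope
  split_ifs <;> constructor <;> linarith

theorem level_mem_Icc (p : InvLim lam) : level p ∈ Icc (0 : ℝ) 1 := by
  -- A partial sum is a composition of `N` affine self-maps of `[0, 1]` evaluated at 0.
  have key : ∀ (N : ℕ) (p : InvLim lam), ∑ r ∈ Finset.range N, levelTerm r p ∈ Icc (0 : ℝ) 1 := by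
    intro N
    induction N with
    | zero => simp
    | succ N ih =>
      intro p
      rw [Finset.sum_range_succ']
      simp only [levelTerm]
      rw [← Finset.mul_sum, add_comm]
      exact affine_mem_Icc p (ih _)
  exact isClosed_Icc.mem_of_tendsto (summable_levelTerm p).hasSum.tendsto_sum_nat
    (Filter.Eventually.of_forall fun N => key N p)

theorem level_of_lt {p : InvLim lam} (h : p.1 0 < tent lam (leftEnd lam)) :
    level p = 1 - level (shift p) := by
  rw [level_eq, levelOffset, levelSlope, if_pos h, if_pos h]; ring

theorem tent_leftEnd_le_of_le_crit {p : InvLim lam} (h : p.1 1 ≤ crit) :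
    ¬ p.1 0 < tent lam (leftEnd lam) := by
  intro h'
  exact absurd (hat_lt_of_lt_tent_leftEnd h') (not_lt.2 (h.trans (crit_lt_hat_leftEnd lam).le))

theorem level_of_le_crit {p : InvLim lam} (h : p.1 1 ≤ crit) :
    level p = level (shift p) / 2 := by
  rw [level_eq, levelOffset, levelSlope, if_neg (tent_leftEnd_le_of_le_crit h),
    if_neg (tent_leftEnd_le_of_le_crit h), if_pos h, if_pos h]
  ring

theorem level_of_crit_lt {p : InvLim lam} (h : ¬ p.1 0 < tent lam (leftEnd lam))
    (h' : crit < p.1 1) : level p = 1 - level (shift p) / 2 := by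
  rw [level_eq, levelOffset, levelSlope, if_neg h, if_neg h, if_neg (not_le.2 h'),
    if_neg (not_le.2 h')]
  ring

theorem level_cases (p : InvLim lam) :
    (p.1 0 < tent lam (leftEnd lam) ∧ crit < p.1 1 ∧ level p = 1 - level (shift p)) ∨
    (¬ p.1 0 < tent lam (leftEnd lam) ∧ p.1 1 ≤ crit ∧ level p = level (shift p) / 2) ∨
    (¬ p.1 0 < tent lam (leftEnd lam) ∧ crit < p.1 1 ∧ level p = 1 - level (shift p) / 2) := by
  by_cases h : p.1 0 < tent lam (leftEnd lam)
  · exact Or.inl ⟨h, (crit_lt_hat_leftEnd lam).trans (hat_lt_of_lt_tent_leftEnd h), level_of_lt h⟩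
  · rcases le_or_gt (p.1 1) crit with h' | h'
    · exact Or.inr (Or.inl ⟨h, h', level_of_le_crit h'⟩)
    · exact Or.inr (Or.inr ⟨h, h', level_of_crit_lt h h'⟩)

theorem affine_congr {p p' : InvLim lam} (h0 : p.1 0 = p'.1 0)
    (h1 : p.1 1 ≤ crit ↔ p'.1 1 ≤ crit) :
    levelOffset p = levelOffset p' ∧ levelSlope p = levelSlope p' := by
  unfold levelOffset levelSlope
  simp only [h0, h1, and_self]

theorem abs_le_of_affine_recursion : ∀ (N : ℕ) (d σ : ℕ → ℝ), (∀ i, |d i| ≤ 1) →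
    (∀ i < N, d i = σ i * d (i + 1)) → (∀ i, |σ i| ≤ 1) → (∀ i, |σ i * σ (i + 1)| ≤ 1 / 2) →
    |d 0| ≤ 2 * (3 / 4) ^ N
  | 0, d, σ, hd, _, _, _ => by have := hd 0; simp only [pow_zero]; linarith
  | 1, d, σ, hd, _, _, _ => by have := hd 0; simp only [pow_one]; linarith
  | N + 2, d, σ, hd, he, h1, h2 => by
    have ih := abs_le_of_affine_recursion N (fun i => d (i + 2)) (fun i => σ (i + 2))
      (fun i => hd _) (fun i hi => he (i + 2) (by omega)) (fun i => h1 _) (fun i => h2 _)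
    rw [he 0 (by omega), he 1 (by omega), ← mul_assoc, abs_mul, pow_add]
    have h3 : (0 : ℝ) < 2 * (3 / 4) ^ N := by positivity
    have h4 := h2 0
    simp only [zero_add] at *
    nlinarith [abs_nonneg (d 2), abs_nonneg (σ 0 * σ 1)]

theorem abs_sub_le_one_of_mem {s t : ℝ} (hs : s ∈ Icc (0 : ℝ) 1) (ht : t ∈ Icc (0 : ℝ) 1) :
    |s - t| ≤ 1 := abs_le.2 ⟨by linarith [hs.1, ht.2], by linarith [hs.2, ht.1]⟩

theorem abs_levelSlope_iterate_mul_le (p : InvLim lam) (i : ℕ) :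
    |levelSlope (shift^[i] p) * levelSlope (shift^[i + 1] p)| ≤ 1 / 2 := by
  rw [Function.iterate_succ_apply']; exact abs_levelSlope_mul_le _

/-- The affine recursion has only one bounded solution along each orbit. -/
theorem level_eq_of_recursion {p : InvLim lam} {t : ℕ → ℝ} (ht : ∀ i, t i ∈ Icc (0 : ℝ) 1)
    (h : ∀ i, t i = levelOffset (shift^[i] p) + levelSlope (shift^[i] p) * t (i + 1)) :
    level p = t 0 := by
  have key : ∀ N, |level p - t 0| ≤ 2 * (3 / 4) ^ N := fun N =>
    abs_le_of_affine_recursion N (fun i => level (shift^[i] p) - t i)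
      (fun i => levelSlope (shift^[i] p)) (fun i => abs_sub_le_one_of_mem (level_mem_Icc _) (ht i))
      (fun i _ => by
        rw [h i, level_eq, Function.iterate_succ_apply']; ring)
      (fun i => abs_levelSlope_le _) (abs_levelSlope_iterate_mul_le p)
  have hlim : Filter.Tendsto (fun N : ℕ => 2 * (3 / 4 : ℝ) ^ N) Filter.atTop (𝓝 (2 * 0)) :=
    (tendsto_pow_atTop_nhds_zero_of_lt_one (by norm_num) (by norm_num)).const_mul 2
  rw [mul_zero] at hlim
  have := ge_of_tendsto' hlim key
  exact sub_eq_zero.1 (abs_eq_zero.1 (le_antisymm this (abs_nonneg _)))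

/-- Points of one fiber with the same first `N` digits have the same first `N + 1` coordinates, so
the same `N` affine maps act on their tails. The contraction then gives a modulus of continuity for
`level`. -/
theorem abs_level_sub_le {p p' : InvLim lam} (N : ℕ) (h0 : p.1 0 = p'.1 0)
    (h : ∀ i < N, (p.1 (i + 1) ≤ crit ↔ p'.1 (i + 1) ≤ crit)) :
    |level p - level p'| ≤ 2 * (3 / 4) ^ N := by
  have hval : ∀ i ≤ N, p.1 i = p'.1 i := by
    intro i
    induction i with
    | zero => exact fun _ => h0
    | succ i ih =>
      intro hi
      have e : tent lam (p.1 (i + 1)) = tent lam (p'.1 (i + 1)) := by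
        rw [p.2.2, p'.2.2, ih (by omega)]
      have h1 := one_lt lam
      have hh := h i (by omega)
      rcases le_or_gt (p.1 (i + 1)) crit with hc | hc
      · rw [tent_of_le hc, tent_of_le (hh.1 hc)] at e
        exact mul_left_cancel₀ (by linarith) e
      · have hc' : crit < p'.1 (i + 1) := not_le.1 fun H => absurd (hh.2 H) (not_le.2 hc)
        rw [tent_of_ge hc.le, tent_of_ge hc'.le] at e
        have := mul_left_cancel₀ (by linarith) e
        linarith
  refine abs_le_of_affine_recursion N (fun i => level (shift^[i] p) - level (shift^[i] p'))
    (fun i => levelSlope (shift^[i] p))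
    (fun i => abs_sub_le_one_of_mem (level_mem_Icc _) (level_mem_Icc _)) (fun i hi => ?_)
    (fun i => abs_levelSlope_le _) (abs_levelSlope_iterate_mul_le p)
  obtain ⟨e1, e2⟩ := affine_congr (p := shift^[i] p) (p' := shift^[i] p')
    (by rw [iterate_shift_val, iterate_shift_val, hval _ (by omega)])
    (by rw [iterate_shift_val, iterate_shift_val, add_comm 1 i]; exact h i hi)
  rw [level_eq (shift^[i] p), level_eq (shift^[i] p'), Function.iterate_succ_apply',
    Function.iterate_succ_apply', e1, e2]
  ring

/-! ### The level function and the order of itineraries -/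

theorem isItin_shift {p : InvLim lam} {s : ℕ → Fin 2} (h : IsItin p s) :
    IsItin (shift p) fun i => s (i + 1) := fun r => h (r + 1)

theorem fin_two_cases (i : Fin 2) : i = 0 ∨ i = 1 := by omega

/-- The digits of the itinerary of a generic point. -/
noncomputable def itin (p : InvLim lam) (r : ℕ) : Fin 2 := if p.1 (r + 1) ≤ crit then 0 else 1

theorem isItin_itin (p : InvLim lam) : IsItin p (itin p) := by
  intro r
  unfold itin proj
  split_ifs with h
  · exact ⟨fun _ => h, fun h => absurd h (by decide)⟩
  · exact ⟨fun h => absurd h (by decide), fun _ => (not_le.1 h).le⟩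

theorem itin_apply (p : InvLim lam) (r : ℕ) :
    itin p r = if proj (r + 1) p ≤ crit then 0 else 1 := rfl

theorem Generic.eq_itin {p : InvLim lam} (hp : Generic p) {s : ℕ → Fin 2} (h : IsItin p s) :
    s = itin p := by
  funext r
  rw [itin_apply]
  rcases fin_two_cases (s r) with e | e
  · rw [if_pos ((h r).1 e), e]
  · have h2 := (h r).2 e
    rw [if_neg (not_le.2 (lt_of_le_of_ne h2 (hp.val_ne_crit _).symm)), e]

theorem itin_eq_iff {p p' : InvLim lam} (r : ℕ) :
    itin p r = itin p' r ↔ (p.1 (r + 1) ≤ crit ↔ p'.1 (r + 1) ≤ crit) := by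
  unfold itin
  split_ifs with h h' h' <;> simp [h, h']

theorem val_eq_of_itin_eq {p p' : InvLim lam} (h0 : p.1 0 = p'.1 0) {k : ℕ}
    (h : ∀ i < k, itin p i = itin p' i) : ∀ i ≤ k, p.1 i = p'.1 i := by
  intro i
  induction i with
  | zero => exact fun _ => h0
  | succ i ih =>
    intro hi
    have e : tent lam (p.1 (i + 1)) = tent lam (p'.1 (i + 1)) := by
      rw [p.2.2, p'.2.2, ih (by omega)]
    have h1 := one_lt lam
    have hh := (itin_eq_iff i).1 (h i (by omega))
    rcases le_or_gt (p.1 (i + 1)) crit with hc | hc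
    · rw [tent_of_le hc, tent_of_le (hh.1 hc)] at e
      exact mul_left_cancel₀ (by linarith) e
    · have hc' : crit < p'.1 (i + 1) := not_le.1 fun H => absurd (hh.2 H) (not_le.2 hc)
      rw [tent_of_ge hc.le, tent_of_ge hc'.le] at e
      have := mul_left_cancel₀ (by linarith) e
      linarith

theorem eq_of_itin_eq {p p' : InvLim lam} (h0 : p.1 0 = p'.1 0) (h : itin p = itin p') :
    p = p' :=
  val_ext fun r => val_eq_of_itin_eq h0 (k := r) (fun i _ => congrFun h i) r le_rfl

theorem val_hat_of_ne {p p' : InvLim lam} {k : ℕ} (h : p.1 k = p'.1 k)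
    (hne : p.1 (k + 1) ≠ p'.1 (k + 1)) : p'.1 (k + 1) = hat (p.1 (k + 1)) := by
  have e : tent lam (p.1 (k + 1)) = tent lam (p'.1 (k + 1)) := by rw [p.2.2, p'.2.2, h]
  rcases (tent_eq_tent_iff lam _ _).1 e with e | e
  · exact absurd e.symm hne
  · exact e

theorem le_crit_of_isItin_zero {p : InvLim lam} {s : ℕ → Fin 2} (h : IsItin p s) (e : s 0 = 0) :
    p.1 1 ≤ crit := (h 0).1 e

theorem Generic.crit_lt_of_isItin_one {p : InvLim lam} (hp : Generic p) {s : ℕ → Fin 2}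
    (h : IsItin p s) (e : s 0 = 1) : crit < p.1 1 :=
  lt_of_le_of_ne ((h 0).2 e) (hp.val_ne_crit _).symm

theorem val_one_eq {p p' : InvLim lam} (h0 : p.1 0 = p'.1 0)
    (h : p.1 1 ≤ crit ↔ p'.1 1 ≤ crit) : p.1 1 = p'.1 1 :=
  val_eq_of_itin_eq h0 (k := 1) (fun i hi => by
    obtain rfl : i = 0 := by omega
    exact (itin_eq_iff 0).2 h) 1 le_rfl

/-- At the first disagreement the digits 0 and 1 put the levels on opposite sides of `1 / 2`. Each
earlier digit 0 applies an increasing map and each digit 1 a decreasing one, which is the parity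
rule of the unimodal order. -/
theorem level_mono_aux : ∀ (r : ℕ) (p p' : InvLim lam) (s t : ℕ → Fin 2), Generic p →
    p.1 0 = p'.1 0 → IsItin p s → IsItin p' t → (∀ i < r, s i = t i) → s r ≠ t r →
    (Even (∑ i ∈ Finset.range (r + 1), (s i : ℕ)) → level p ≤ level p') ∧
    (¬ Even (∑ i ∈ Finset.range (r + 1), (s i : ℕ)) → level p' ≤ level p) := by
  intro r
  induction r with
  | zero =>
    intro p p' s t hp h0 hs ht _ hne
    have hp' : Generic p' := by unfold Generic; rwa [← h0]
    have b := level_mem_Icc (shift p)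
    have b' := level_mem_Icc (shift p')
    simp only [zero_add, Finset.sum_range_one]
    rcases fin_two_cases (s 0) with e | e
    · have e' : t 0 = 1 := by rcases fin_two_cases (t 0) with e' | e' <;> simp_all
      have l := le_crit_of_isItin_zero hs e
      have nb := tent_leftEnd_le_of_le_crit l
      rw [level_of_le_crit l, level_of_crit_lt (h0 ▸ nb) (hp'.crit_lt_of_isItin_one ht e'), e]
      refine ⟨fun _ => by linarith [b.2, b'.2], fun h => absurd (by simp) h⟩
    · have e' : t 0 = 0 := by rcases fin_two_cases (t 0) with e' | e' <;> simp_all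
      have l := le_crit_of_isItin_zero ht e'
      have nb := tent_leftEnd_le_of_le_crit l
      rw [level_of_le_crit l, level_of_crit_lt (h0 ▸ nb) (hp.crit_lt_of_isItin_one hs e), e]
      refine ⟨fun h => absurd h (by simp), fun _ => by linarith [b.2, b'.2]⟩
  | succ r ih =>
    intro p p' s t hp h0 hs ht hi hne
    have hp' : Generic p' := by unfold Generic; rwa [← h0]
    have hd : p.1 1 ≤ crit ↔ p'.1 1 ≤ crit := by
      have := hi 0 (by omega)
      rw [hp.eq_itin hs, hp'.eq_itin ht] at this
      exact (itin_eq_iff 0).1 this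
    have := ih (shift p) (shift p') _ _ (generic_shift.2 hp) (val_one_eq h0 hd) (isItin_shift hs)
      (isItin_shift ht) (fun i h => hi (i + 1) (by omega)) hne
    obtain ⟨i1, i2⟩ := this
    rw [Finset.sum_range_succ']
    rcases fin_two_cases (s 0) with e | e
    · have l := le_crit_of_isItin_zero hs e
      rw [level_of_le_crit l, level_of_le_crit (hd.1 l), e]
      simp only [Fin.val_zero, add_zero]
      exact ⟨fun h => by linarith [i1 h], fun h => by linarith [i2 h]⟩
    · have l := hp.crit_lt_of_isItin_one hs e
      have l' : crit < p'.1 1 := not_le.1 fun H => absurd (hd.2 H) (not_le.2 l)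
      rw [e]
      simp only [Fin.val_one, Nat.even_add_one, not_not]
      by_cases nb : p.1 0 < tent lam (leftEnd lam)
      · have nb' : p'.1 0 < tent lam (leftEnd lam) := h0 ▸ nb
        rw [level_of_lt nb, level_of_lt nb']
        exact ⟨fun h => by linarith [i2 h], fun h => by linarith [i1 h]⟩
      · rw [level_of_crit_lt nb l, level_of_crit_lt (h0 ▸ nb) l']
        exact ⟨fun h => by linarith [i2 h], fun h => by linarith [i1 h]⟩

theorem level_mono {p p' : InvLim lam} {s t : ℕ → Fin 2} (hp : Generic p) (h0 : p.1 0 = p'.1 0)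
    (hs : IsItin p s) (ht : IsItin p' t) (h : UniLT s t) : level p ≤ level p' := by
  obtain ⟨r, h1, h2, h3⟩ := h
  exact (level_mono_aux r p p' s t hp h0 hs ht h1 h2).1 h3

theorem uniLT_or_uniLT {s t : ℕ → Fin 2} (h : s ≠ t) : UniLT s t ∨ UniLT t s := by
  classical
  have hex : ∃ r, s r ≠ t r := Function.ne_iff.1 h
  set r := Nat.find hex
  have hr : s r ≠ t r := Nat.find_spec hex
  have hlt : ∀ i < r, s i = t i := fun i hi => not_not.1 (Nat.find_min hex hi)
  have hsum : ∑ i ∈ Finset.range r, (s i : ℕ) = ∑ i ∈ Finset.range r, (t i : ℕ) :=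
    Finset.sum_congr rfl fun i hi => by rw [hlt i (Finset.mem_range.1 hi)]
  by_cases he : Even (∑ i ∈ Finset.range (r + 1), (s i : ℕ))
  · exact Or.inl ⟨r, hlt, hr, he⟩
  · refine Or.inr ⟨r, fun i hi => (hlt i hi).symm, hr.symm, ?_⟩
    rw [Finset.sum_range_succ] at he ⊢
    rw [← hsum]
    rcases fin_two_cases (s r) with e | e <;> rcases fin_two_cases (t r) with e' | e'
    · exact absurd (e.trans e'.symm) hr
    · rw [e] at he; rw [e']; simpa [Nat.even_add_one] using he
    · rw [e] at he; rw [e']; simpa [Nat.even_add_one] using he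
    · exact absurd (e.trans e'.symm) hr

theorem level_lt_imp {p p' : InvLim lam} {s t : ℕ → Fin 2} (hp : Generic p) (h0 : p.1 0 = p'.1 0)
    (hs : IsItin p s) (ht : IsItin p' t) (h : level p < level p') : UniLT s t := by
  have hp' : Generic p' := by unfold Generic; rwa [← h0]
  have hne : s ≠ t := by
    rintro rfl
    rw [eq_of_itin_eq h0 ((hp.eq_itin hs).symm.trans (hp'.eq_itin ht))] at h
    exact lt_irrefl _ h
  rcases uniLT_or_uniLT hne with h' | h'
  · exact h'
  · exact absurd (level_mono hp' h0.symm ht hs h') (not_le.2 h)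

/-- At the first disagreement of two points of a fiber with the same level, both tails have
level `1`. -/
theorem level_eq_aux : ∀ (k : ℕ) (p p' : InvLim lam), Generic p → (∀ i ≤ k, p.1 i = p'.1 i) →
    p.1 (k + 1) ≠ p'.1 (k + 1) → level p = level p' →
    level (shift^[k + 1] p) = 1 ∧ level (shift^[k + 1] p') = 1 ∧ level p ∈ Ioo (0 : ℝ) 1 := by
  intro k
  induction k with
  | zero =>
    intro p p' hp hi hne he
    have h0 := hi 0 le_rfl
    have b := level_mem_Icc (shift p)
    have b' := level_mem_Icc (shift p')
    have hd : ¬ (p.1 1 ≤ crit ↔ p'.1 1 ≤ crit) := fun h => hne (val_one_eq h0 h)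
    simp only [zero_add, Function.iterate_one]
    -- One point takes the left branch and the other the right, so `t / 2 = 1 - t' / 2` with `t, t'
    -- ≤ 1`. This forces `t = t' = 1` and common level `1 / 2`.
    rcases le_or_gt (p.1 1) crit with l | l
    · have l' : crit < p'.1 1 := not_le.1 fun H => hd ⟨fun _ => H, fun _ => l⟩
      have nb := tent_leftEnd_le_of_le_crit l
      rw [level_of_le_crit l] at he ⊢
      rw [level_of_crit_lt (h0 ▸ nb) l'] at he
      refine ⟨?_, ?_, ?_, ?_⟩ <;> linarith [b.2, b'.2]
    · have l' : p'.1 1 ≤ crit := by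
        by_contra H
        exact hd ⟨fun h => absurd h (not_le.2 l), fun h => absurd h H⟩
      have nb := tent_leftEnd_le_of_le_crit l'
      rw [level_of_crit_lt (h0 ▸ nb) l] at he ⊢
      rw [level_of_le_crit l'] at he
      refine ⟨?_, ?_, ?_, ?_⟩ <;> linarith [b.2, b'.2]
  | succ k ih =>
    intro p p' hp hi hne he
    have h0 := hi 0 (by omega)
    have h1 := hi 1 (by omega)
    obtain ⟨e1, e2⟩ := affine_congr h0 (by rw [h1])
    -- Both points undergo the same affine map, whose slope is nonzero, so it can be cancelled.
    have he' : level (shift p) = level (shift p') := by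
      rw [level_eq p, level_eq p', e1, e2] at he
      refine mul_left_cancel₀ ?_ (add_left_cancel he)
      unfold levelSlope; split_ifs <;> norm_num
    obtain ⟨i1, i2, i3, i4⟩ := ih (shift p) (shift p') (generic_shift.2 hp)
      (fun i h => hi (i + 1) (by omega)) hne he'
    refine ⟨i1, i2, ?_⟩
    rcases level_cases p with ⟨-, -, e⟩ | ⟨-, -, e⟩ | ⟨-, -, e⟩ <;> rw [e] <;>
      constructor <;> linarith

theorem exists_first_difference {p p' : InvLim lam} (h0 : p.1 0 = p'.1 0) (hne : p ≠ p') :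
    ∃ k, (∀ i ≤ k, p.1 i = p'.1 i) ∧ p.1 (k + 1) ≠ p'.1 (k + 1) := by
  classical
  have hex : ∃ r, p.1 r ≠ p'.1 r := by
    by_contra H
    push Not at H
    exact hne (val_ext H)
  obtain ⟨k, hk⟩ : ∃ k, Nat.find hex = k + 1 := by
    refine Nat.exists_eq_succ_of_ne_zero fun h => ?_
    have := Nat.find_spec hex
    rw [h] at this
    exact this h0
  refine ⟨k, fun i hi => not_not.1 (Nat.find_min hex (by omega)), ?_⟩
  rw [← hk]
  exact Nat.find_spec hex

/-- A level shared by two points is an image of `1 / 2` under maps preserving `(0, 1)`, so the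
values 0 and 1 cannot be shared. -/
theorem eq_of_level_eq {p p' : InvLim lam} (hp : Generic p) (h0 : p.1 0 = p'.1 0)
    (h : level p = level p') (hex : level p = 0 ∨ level p = 1) : p = p' := by
  by_contra hne
  obtain ⟨k, h1, h2⟩ := exists_first_difference h0 hne
  obtain ⟨-, -, h3, h4⟩ := level_eq_aux k p p' hp h1 h2 h
  rcases hex with e | e <;> linarith

/-! ### Realization of every level on a generic fiber. -/

/-- One step of the construction of a point of given level. -/
noncomputable def descend (lam : Slope) (w : ℝ × ℝ) : ℝ × ℝ :=
  if w.1 < tent lam (leftEnd lam) then (1 - w.1 / lam, 1 - w.2)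
  else if w.2 ≤ 1 / 2 then (w.1 / lam, 2 * w.2) else (1 - w.1 / lam, 2 * (1 - w.2))

theorem descend_spec {w : ℝ × ℝ} (h1 : w.1 ∈ core lam) (h2 : w.1 ∉ grandOrbit lam)
    (h3 : w.2 ∈ Icc (0 : ℝ) 1) :
    (descend lam w).1 ∈ core lam ∧ tent lam (descend lam w).1 = w.1 ∧
      (descend lam w).1 ∉ grandOrbit lam ∧ (descend lam w).2 ∈ Icc (0 : ℝ) 1 ∧
      w.2 = (if w.1 < tent lam (leftEnd lam) then 1 else
          if (descend lam w).1 ≤ crit then 0 else 1) +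
        (if w.1 < tent lam (leftEnd lam) then -1 else
          if (descend lam w).1 ≤ crit then 1 / 2 else -(1 / 2)) * (descend lam w).2 := by
  obtain ⟨x, t⟩ := w
  simp only at h1 h2 h3
  have hl := one_lt lam
  have hpos : (0 : ℝ) < lam := by linarith
  -- Being off the grand orbit excludes `x = b`, so the candidate preimages lie strictly on either
  -- side of `c`.
  have hxb : x < rightEnd lam :=
    lt_of_le_of_ne h1.2 fun h => h2 (h ▸ rightEnd_mem_grandOrbit lam)
  have hlx : (lam : ℝ) * (x / lam) = x := by field_simp
  have hup : crit < 1 - x / lam := by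
    rw [rightEnd_eq] at hxb; unfold crit; nlinarith
  have hup1 : 1 - x / lam ∈ core lam := by
    refine ⟨((leftEnd_lt_crit lam).trans hup).le, ?_⟩
    have := h1.1
    rw [leftEnd_eq] at this
    rw [rightEnd_eq]; nlinarith
  have hup2 : tent lam (1 - x / lam) = x := by rw [tent_of_ge hup.le]; linarith
  have hup3 : 1 - x / lam ∉ grandOrbit lam := by
    rw [← tent_mem_grandOrbit_iff hup1, hup2]; exact h2
  by_cases hb : x < tent lam (leftEnd lam)
  · simp only [descend, if_pos hb]
    exact ⟨hup1, hup2, hup3, ⟨by linarith [h3.2], by linarith [h3.1]⟩, by ring⟩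
  · by_cases ht : t ≤ 1 / 2
    · have hlo : x / lam ≤ crit := by
        rw [rightEnd_eq] at hxb; unfold crit; nlinarith
      have hlo2 : tent lam (x / lam) = x := by rw [tent_of_le hlo]; linarith
      have hlo1 : x / lam ∈ core lam := by
        refine ⟨?_, hlo.trans (crit_lt_rightEnd lam).le⟩
        rw [not_lt, tent_leftEnd] at hb
        nlinarith
      have hlo3 : x / lam ∉ grandOrbit lam := by
        rw [← tent_mem_grandOrbit_iff hlo1, hlo2]; exact h2
      simp only [descend, if_neg hb, if_pos ht, if_pos hlo]
      exact ⟨hlo1, hlo2, hlo3, ⟨by linarith [h3.1], by linarith⟩, by ring⟩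
    · simp only [descend, if_neg hb, if_neg ht, if_neg (not_le.2 hup)]
      exact ⟨hup1, hup2, hup3, ⟨by linarith [h3.2], by linarith⟩, by ring⟩

/-- Descending, the preimage is chosen by the half of `[0, 1]` containing the current target, and
the target is rescaled. The targets form a bounded solution of the recursion, and uniqueness of that
solution identifies them with the levels. -/
theorem exists_level_eq {x t : ℝ} (hx : x ∈ core lam) (hg : x ∉ grandOrbit lam)
    (ht : t ∈ Icc (0 : ℝ) 1) : ∃ p : InvLim lam, p.1 0 = x ∧ level p = t := by
  set w : ℕ → ℝ × ℝ := fun i => (descend lam)^[i] (x, t) with hw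
  have hs : ∀ i, w (i + 1) = descend lam (w i) := fun i => Function.iterate_succ_apply' _ _ _
  have inv : ∀ i, (w i).1 ∈ core lam ∧ (w i).1 ∉ grandOrbit lam ∧ (w i).2 ∈ Icc (0 : ℝ) 1 := by
    intro i
    induction i with
    | zero => exact ⟨hx, hg, ht⟩
    | succ i ih =>
      obtain ⟨h1, -, h2, h3, -⟩ := descend_spec ih.1 ih.2.1 ih.2.2
      rw [hs]; exact ⟨h1, h2, h3⟩
  obtain ⟨p, hp⟩ : ∃ p : InvLim lam, ∀ i, p.1 i = (w i).1 :=
    ⟨⟨fun i => (w i).1, fun i => (inv i).1, fun i => by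
      simp only [hs]; exact (descend_spec (inv i).1 (inv i).2.1 (inv i).2.2).2.1⟩, fun _ => rfl⟩
  refine ⟨p, hp 0, level_eq_of_recursion (t := fun i => (w i).2) (fun i => (inv i).2.2) fun i => ?_⟩
  have := (descend_spec (inv i).1 (inv i).2.1 (inv i).2.2).2.2.2.2
  rw [← hs, ← hp, ← hp] at this
  simp only [levelOffset, levelSlope, iterate_shift_val, zero_add, add_comm 1 i]
  exact this

/-! ### Extreme and consecutive elements in terms of levels -/

/-- The level of the extreme elements of a given side. -/
def sideLevel : Side → ℝ
  | .lower => 0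
  | .upper => 1

theorem sideLevel_mem (side : Side) : sideLevel side = 0 ∨ sideLevel side = 1 := by
  cases side
  · exact Or.inl rfl
  · exact Or.inr rfl

theorem sideLevel_injective : Function.Injective sideLevel := by
  rintro (_ | _) (_ | _) h <;> simp [sideLevel] at h ⊢

theorem isExtremeElt_iff {side : Side} {x : ℝ} (hg : x ∉ grandOrbit lam) {p : InvLim lam} :
    IsExtremeElt side x p ↔ p.1 0 = x ∧ level p = sideLevel side := by
  have gen : p.1 0 = x → Generic p := fun h => by unfold Generic; rwa [h]
  cases side with
  | lower =>
    constructor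
    · rintro ⟨h0, s, hs, hmin⟩
      refine ⟨h0, ?_⟩
      change p.1 0 = x at h0
      obtain ⟨q, hq, hq'⟩ := exists_level_eq (t := 0) (h0 ▸ p.2.1 0) hg ⟨le_rfl, zero_le_one⟩
      have h00 := h0.trans hq.symm
      rcases hmin _ ⟨q, hq, isItin_itin q⟩ with e | e
      · have hi := ((gen h0).eq_itin hs).symm.trans e
        rw [eq_of_itin_eq h00 hi, hq']; rfl
      · have := level_mono (gen h0) h00 hs (isItin_itin q) e
        rw [hq'] at this
        exact le_antisymm this (level_mem_Icc p).1
    · rintro ⟨h0, hl⟩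
      refine ⟨h0, itin p, isItin_itin p, ?_⟩
      rintro t ⟨q, hq, ht⟩
      change q.1 0 = x at hq
      have hgq : Generic q := by unfold Generic; rwa [hq]
      by_cases e : itin p = t
      · exact Or.inl e
      rcases uniLT_or_uniLT e with h | h
      · exact Or.inr h
      · have h1 := level_mono hgq (hq.trans h0.symm) ht (isItin_itin p) h
        have h2 : level p = level q := le_antisymm (hl ▸ (level_mem_Icc q).1) h1
        obtain rfl := eq_of_level_eq (gen h0) (h0.trans hq.symm) h2 (Or.inl hl)
        exact Or.inl ((gen h0).eq_itin ht).symm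
  | upper =>
    constructor
    · rintro ⟨h0, s, hs, hmin⟩
      refine ⟨h0, ?_⟩
      change p.1 0 = x at h0
      obtain ⟨q, hq, hq'⟩ := exists_level_eq (t := 1) (h0 ▸ p.2.1 0) hg ⟨zero_le_one, le_rfl⟩
      have h00 := h0.trans hq.symm
      rcases hmin _ ⟨q, hq, isItin_itin q⟩ with e | e
      · have hi := ((gen h0).eq_itin hs).symm.trans e.symm
        rw [eq_of_itin_eq h00 hi, hq']; rfl
      · have := level_mono (by unfold Generic; rwa [hq]) h00.symm (isItin_itin q) hs e
        rw [hq'] at this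
        exact le_antisymm (level_mem_Icc p).2 this
    · rintro ⟨h0, hl⟩
      refine ⟨h0, itin p, isItin_itin p, ?_⟩
      rintro t ⟨q, hq, ht⟩
      change q.1 0 = x at hq
      by_cases e : t = itin p
      · exact Or.inl e
      rcases uniLT_or_uniLT e with h | h
      · exact Or.inr h
      · have h1 := level_mono (gen h0) (h0.trans hq.symm) (isItin_itin p) ht h
        have h2 : level p = level q := le_antisymm h1 (hl ▸ (level_mem_Icc q).2)
        obtain rfl := eq_of_level_eq (gen h0) (h0.trans hq.symm) h2 (Or.inr hl)
        exact Or.inl ((gen h0).eq_itin ht)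

/-- The tails of `u` and `v` from coordinate `k + 1` both have level 1 and start at the same point,
so they coincide. -/
theorem eq_of_level_eq_of_ne {k : ℕ} {u v w : InvLim lam} (hu : Generic u)
    (huw : ∀ i ≤ k, u.1 i = w.1 i) (hne : u.1 (k + 1) ≠ w.1 (k + 1))
    (huv : ∀ i ≤ k + 1, u.1 i = v.1 i) (h1 : level u = level w) (h2 : level v = level w) :
    u = v := by
  have hv : Generic v := by unfold Generic; rwa [← huv 0 (by omega)]
  obtain ⟨b1, -, -⟩ := level_eq_aux k u w hu huw hne h1
  obtain ⟨b2, -, -⟩ := level_eq_aux k v w hv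
    (fun i hi => (huv i (by omega)).symm.trans (huw i hi)) (by rwa [← huv _ le_rfl]) h2
  have e := eq_of_level_eq ((generic_iterate_shift (k + 1)).2 hu) (p' := shift^[k + 1] v)
    (by rw [iterate_shift_val, iterate_shift_val, zero_add, huv _ le_rfl]) (b1.trans b2.symm)
    (Or.inr b1)
  refine val_ext fun r => ?_
  rcases Nat.lt_or_ge (k + 1) r with h | h
  · obtain ⟨d, rfl⟩ := Nat.exists_eq_add_of_le h.le
    have := congrArg (fun z : InvLim lam => z.1 d) e
    simp only [iterate_shift_val] at this
    rwa [add_comm] at this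
  · exact huv r h

/-- A level is attained at most twice on a generic fiber. -/
theorem not_three_level_eq {u v w : InvLim lam} (hu : Generic u) (h1 : u.1 0 = v.1 0)
    (h2 : u.1 0 = w.1 0) (e1 : level u = level v) (e2 : level u = level w) (huv : u ≠ v)
    (huw : u ≠ w) (hvw : v ≠ w) : False := by
  have hv : Generic v := by unfold Generic; rwa [← h1]
  obtain ⟨k, a1, a2⟩ := exists_first_difference h1 huv
  obtain ⟨l, b1, b2⟩ := exists_first_difference h2 huw
  -- Whichever of `v`, `w` leaves `u` first, the remaining two agree past that coordinate and
  -- coincide. If both leave together, both take the mirror image of the coordinate of `u` and so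
  -- agree there.
  rcases lt_trichotomy k l with h | rfl | h
  · exact huw (eq_of_level_eq_of_ne hu a1 a2 (fun i hi => b1 i (by omega)) e1 (e2.symm.trans e1))
  · refine hvw (eq_of_level_eq_of_ne hv (fun i hi => (a1 i hi).symm) a2.symm (fun i hi => ?_)
      e1.symm e2.symm)
    rcases Nat.lt_or_ge k i with h | h
    · obtain rfl : i = k + 1 := by omega
      rw [val_hat_of_ne (a1 k le_rfl) a2, val_hat_of_ne (b1 k le_rfl) b2]
    · exact (a1 i h).symm.trans (b1 i h)
  · exact huv (eq_of_level_eq_of_ne hu b1 b2 (fun i hi => a1 i (by omega)) e2 (e1.symm.trans e2))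

theorem not_uniLT_self (s : ℕ → Fin 2) : ¬ UniLT s s := fun ⟨_, _, h, _⟩ => h rfl

theorem not_between {p p' q : InvLim lam} (gp : Generic p) (h0 : p.1 0 = p'.1 0)
    (hq : p.1 0 = q.1 0) (hne : p ≠ p') (he : level p = level p')
    (h1 : UniLT (itin p) (itin q)) (h2 : UniLT (itin q) (itin p')) : False := by
  have gq : Generic q := by unfold Generic; rwa [← hq]
  have l1 := level_mono gp hq (isItin_itin p) (isItin_itin q) h1
  have l2 := level_mono gq (hq.symm.trans h0) (isItin_itin q) (isItin_itin p') h2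
  have n1 : p ≠ q := by rintro rfl; exact not_uniLT_self _ h1
  have n2 : q ≠ p' := by rintro rfl; exact not_uniLT_self _ h2
  exact not_three_level_eq gp h0 hq he (by linarith) hne n1 n2.symm

/-- If the levels differ, a point at their mean separates the itineraries. If they agree, anything
in between would be a third point at the same level. -/
theorem consecutive_iff {x : ℝ} (hg : x ∉ grandOrbit lam) {p p' : InvLim lam}
    (h0 : p.1 0 = x) (h0' : p'.1 0 = x) (hne : p ≠ p') :
    Consecutive x p p' ↔ level p = level p' := by
  have gp : Generic p := by unfold Generic; rwa [h0]
  have gp' : Generic p' := by unfold Generic; rwa [h0']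
  constructor
  · rintro ⟨-, -, -, h⟩
    have key : ∀ u v : InvLim lam, u.1 0 = x → v.1 0 = x → level u < level v →
        ∃ t ∈ fiberItins lam x, UniLT (itin u) t ∧ UniLT t (itin v) := by
      intro u v hu hv hlt
      have gu : Generic u := by unfold Generic; rwa [hu]
      obtain ⟨q, hq, hl⟩ := exists_level_eq (t := (level u + level v) / 2) (hu ▸ u.2.1 0) hg
        ⟨by linarith [(level_mem_Icc u).1, (level_mem_Icc v).1],
          by linarith [(level_mem_Icc u).2, (level_mem_Icc v).2]⟩
      have gq : Generic q := by unfold Generic; rwa [hq]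
      exact ⟨itin q, ⟨q, hq, isItin_itin q⟩,
        level_lt_imp gu (hu.trans hq.symm) (isItin_itin u) (isItin_itin q) (by linarith),
        level_lt_imp gq (hq.trans hv.symm) (isItin_itin q) (isItin_itin v) (by linarith)⟩
    rcases lt_trichotomy (level p) (level p') with hlt | he | hlt
    · obtain ⟨t, ht, h1⟩ := key p p' h0 h0' hlt
      exact absurd h1 (h _ _ (isItin_itin p) (isItin_itin p') t ht).1
    · exact he
    · obtain ⟨t, ht, h1⟩ := key p' p h0' h0 hlt
      exact absurd h1 (h _ _ (isItin_itin p) (isItin_itin p') t ht).2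
  · intro he
    refine ⟨h0, h0', hne, ?_⟩
    rintro s s' hs hs' t ⟨q, hq, ht⟩
    have gq : Generic q := by
      unfold Generic; rwa [show q.1 0 = x from hq]
    rw [gp.eq_itin hs, gp'.eq_itin hs', gq.eq_itin ht]
    exact ⟨fun h => not_between gp (h0.trans h0'.symm) (h0.trans hq.symm) hne he h.1 h.2,
      fun h => not_between gp' (h0'.trans h0.symm) (h0'.trans hq.symm) hne.symm he.symm h.1 h.2⟩

theorem level_mem_Ioo_of_eq {p p' : InvLim lam} (hp : Generic p) (h0 : p.1 0 = p'.1 0)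
    (hne : p ≠ p') (h : level p = level p') : level p ∈ Ioo (0 : ℝ) 1 := by
  obtain ⟨k, h1, h2⟩ := exists_first_difference h0 hne
  exact (level_eq_aux k p p' hp h1 h2 h).2.2

/-! ### Backward orbits of extreme elements -/

/-- Level 0 or 1 with two preimages available forces tail level 0. Tail level 1 can arise only from
the single-preimage case, where `x₁ > â`. -/
theorem level_shift_of_extreme {p : InvLim lam} (h : level p = 0 ∨ level p = 1) :
    (level (shift p) = 0 ∨ level (shift p) = 1) ∧
      (level (shift p) = 1 → hat (leftEnd lam) < p.1 1) := by
  have b := level_mem_Icc (shift p)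
  rcases level_cases p with ⟨h1, -, e⟩ | ⟨-, -, e⟩ | ⟨-, -, e⟩
  · refine ⟨?_, fun _ => hat_lt_of_lt_tent_leftEnd h1⟩
    rcases h with h | h
    · right; linarith
    · left; linarith
  · have : level (shift p) = 0 := by rcases h with h | h <;> linarith [b.1, b.2]
    exact ⟨Or.inl this, fun h' => by linarith⟩
  · have : level (shift p) = 0 := by rcases h with h | h <;> linarith [b.1, b.2]
    exact ⟨Or.inl this, fun h' => by linarith⟩

theorem level_iterate_shift_of_extreme {p : InvLim lam} (h : level p = 0 ∨ level p = 1) (d : ℕ) :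
    level (shift^[d] p) = 0 ∨ level (shift^[d] p) = 1 := by
  induction d with
  | zero => exact h
  | succ d ih => rw [Function.iterate_succ_apply']; exact (level_shift_of_extreme ih).1

theorem hat_leftEnd_lt_of_level_eq_one {p : InvLim lam} (h : level p = 0 ∨ level p = 1) {d : ℕ}
    (hd : 0 < d) (h1 : level (shift^[d] p) = 1) : hat (leftEnd lam) < p.1 d := by
  obtain ⟨d, rfl⟩ := Nat.exists_eq_succ_of_ne_zero hd.ne'
  rw [Function.iterate_succ_apply'] at h1
  have := (level_shift_of_extreme (level_iterate_shift_of_extreme h d)).2 h1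
  rwa [iterate_shift_val, add_comm] at this

/-- Two upper extreme elements above points of the gap which are exchanged by the involution. -/
structure FoldPair (q q' : InvLim lam) : Prop where
  generic : Generic q
  level_left : level q = 1
  level_right : level q' = 1
  leftEnd_lt : leftEnd lam < q.1 0
  lt_hat : q.1 0 < hat (leftEnd lam)
  val_eq : q'.1 0 = hat (q.1 0)

theorem FoldPair.generic_right {q q' : InvLim lam} (h : FoldPair q q') : Generic q' := by
  have := h.generic
  unfold Generic at *
  rwa [h.val_eq, hat_mem_grandOrbit_iff (q.2.1 0) (h.val_eq ▸ q'.2.1 0)]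

theorem FoldPair.symm {q q' : InvLim lam} (h : FoldPair q q') : FoldPair q' q := by
  have h1 := h.leftEnd_lt
  have h2 := h.lt_hat
  refine ⟨h.generic_right, h.level_right, h.level_left, ?_, ?_, ?_⟩
  · rw [h.val_eq]; unfold hat at *; linarith
  · rw [h.val_eq]; unfold hat at *; linarith
  · rw [h.val_eq, hat_hat]

theorem FoldPair.right_unique {q q₁ q₂ : InvLim lam} (h₁ : FoldPair q q₁) (h₂ : FoldPair q q₂) :
    q₁ = q₂ :=
  eq_of_level_eq h₁.generic_right (h₁.val_eq.trans h₂.val_eq.symm)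
    (h₁.level_right.trans h₂.level_right.symm) (Or.inr h₁.level_right)

/-- The partner relation: images of fold pairs under the powers of the natural extension. -/
def Folded (p p' : InvLim lam) : Prop :=
  ∃ (r : ℤ) (q q' : InvLim lam), FoldPair q q' ∧ p = (natExt lam ^ r) q ∧ p' = (natExt lam ^ r) q'

theorem Folded.symm {p p' : InvLim lam} (h : Folded p p') : Folded p' p := by
  obtain ⟨r, q, q', hq, rfl, rfl⟩ := h
  exact ⟨r, q', q, hq.symm, rfl, rfl⟩

theorem Folded.generic {p p' : InvLim lam} (h : Folded p p') : Generic p := by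
  obtain ⟨r, q, q', hq, rfl, rfl⟩ := h
  exact (generic_zpow r).2 hq.generic

/-- If `s < r`, then `q₁` is a proper backward iterate of the upper extreme element `q₂`; having
level 1 it would lie to the right of `â`. Hence the exponent in `Folded` is determined by the point,
which makes partners unique. -/
theorem not_lt_of_zpow_eq {q₁ q₂ : InvLim lam} {r s : ℤ} (h1 : level q₁ = 1) (h2 : level q₂ = 1)
    (hlt : q₁.1 0 < hat (leftEnd lam)) (h : (natExt lam ^ r) q₁ = (natExt lam ^ s) q₂) :
    ¬ s < r := by
  intro hsr
  obtain ⟨d, hd⟩ := Int.eq_ofNat_of_zero_le (sub_nonneg.2 hsr.le)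
  have e : q₁ = shift^[d] q₂ := by
    rw [← zpow_natExt_neg_ofNat, ← hd, neg_sub, sub_eq_neg_add, zpow_add, Equiv.Perm.mul_apply, ← h,
      ← Equiv.Perm.mul_apply, ← zpow_add, neg_add_cancel, zpow_zero, Equiv.Perm.one_apply]
  have := hat_leftEnd_lt_of_level_eq_one (Or.inr h2) (d := d) (by omega) (e ▸ h1)
  rw [e, iterate_shift_val, zero_add] at hlt
  exact lt_asymm this hlt

theorem Folded.right_unique {p p₁ p₂ : InvLim lam} (h₁ : Folded p p₁) (h₂ : Folded p p₂) :
    p₁ = p₂ := by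
  obtain ⟨r, q, q', hq, rfl, rfl⟩ := h₁
  obtain ⟨s, u, u', hu, e, rfl⟩ := h₂
  have hrs : r = s := le_antisymm
    (not_lt.1 (not_lt_of_zpow_eq hq.level_left hu.level_left hq.lt_hat e))
    (not_lt.1 (not_lt_of_zpow_eq hu.level_left hq.level_left hu.lt_hat e.symm))
  subst hrs
  obtain rfl := (natExt lam ^ r).injective e
  rw [hq.right_unique hu]

/-! ### The outside map on extreme elements -/

/-- The extreme element `p` sits above the point `w` of the circle. -/
def Marks (w : Side × ℝ) (p : InvLim lam) : Prop := p.1 0 = w.2 ∧ level p = sideLevel w.1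

theorem Marks.extreme {w : Side × ℝ} {p : InvLim lam} (h : Marks w p) :
    level p = 0 ∨ level p = 1 := h.2 ▸ sideLevel_mem w.1

theorem Marks.eq {w : Side × ℝ} {p p' : InvLim lam} (hp : Generic p) (h : Marks w p)
    (h' : Marks w p') : p = p' :=
  eq_of_level_eq hp (h.1.trans h'.1.symm) (h.2.trans h'.2.symm) h.extreme

/-- Off the gap, the outside map describes the action of `f̂` on extreme elements. A generic upper
point off the gap lies to the right of `â`, since `a` and `â` are in the grand orbit. -/
theorem Marks.natExt {w : Side × ℝ} {p : InvLim lam} (hp : Generic p) (h : Marks w p)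
    (hw : w ∉ gap lam) : Marks (outsideMap lam w) (TentSphere.natExt lam p) := by
  obtain ⟨side, x⟩ := w
  obtain ⟨h0, hl⟩ := h
  simp only at h0 hl
  subst h0
  cases side with
  | lower =>
    simp only [sideLevel] at hl
    by_cases hc : p.1 0 ≤ crit
    · rw [outsideMap, if_pos hc]
      refine ⟨rfl, ?_⟩
      rw [level_of_le_crit (p := TentSphere.natExt lam p) hc, shift_natExt, hl]
      simp [sideLevel]
    · rw [outsideMap, if_neg hc]
      refine ⟨rfl, ?_⟩
      rcases level_cases (TentSphere.natExt lam p) with ⟨-, -, e⟩ | ⟨-, h1, -⟩ | ⟨-, -, e⟩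
      · rw [e, shift_natExt, hl]; simp [sideLevel]
      · exact absurd h1 hc
      · rw [e, shift_natExt, hl]; simp [sideLevel]
  | upper =>
    simp only [sideLevel] at hl
    have hx : hat (leftEnd lam) < p.1 0 := by
      by_contra H
      exact hw ⟨rfl, hp.leftEnd_lt 0, lt_of_le_of_ne (not_lt.1 H) (hp.ne_hat_leftEnd 0)⟩
    rw [outsideMap, if_pos hx]
    refine ⟨rfl, ?_⟩
    rw [level_of_lt (p := TentSphere.natExt lam p) (tent_lt_of_hat_lt hx), shift_natExt, hl]
    simp [sideLevel]

theorem outsideMap_mem_neverGap {w : Side × ℝ} (hw : w ∈ neverGap lam) :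
    (outsideMap lam w).2 = tent lam w.2 ∧ outsideMap lam w ∈ neverGap lam := by
  have key : (outsideMap lam w).2 = tent lam w.2 := by
    obtain ⟨side, x⟩ := w
    cases side with
    | lower => simp only [outsideMap]; split_ifs <;> rfl
    | upper =>
      simp only [outsideMap]
      split_ifs with h
      · rfl
      · rcases eq_or_lt_of_le hw.1.1 with e | e
        · exact congrArg (tent lam) e
        · rcases eq_or_lt_of_le (not_lt.1 h) with e' | e'
          · exact (tent_hat (lam := lam) (leftEnd lam)).symm.trans (congrArg (tent lam) e'.symm)
          · exact absurd ⟨rfl, e, e'⟩ (hw.2 0)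
  refine ⟨key, key ▸ tent_mem_core lam hw.1, fun r => ?_⟩
  rw [← Function.iterate_succ_apply]
  exact hw.2 (r + 1)

theorem iterate_outsideMap_mem_neverGap {w : Side × ℝ} (hw : w ∈ neverGap lam) (k : ℕ) :
    ((outsideMap lam)^[k] w).2 = (tent lam)^[k] w.2 ∧ (outsideMap lam)^[k] w ∈ neverGap lam := by
  induction k with
  | zero => exact ⟨rfl, hw⟩
  | succ k ih =>
    have := outsideMap_mem_neverGap ih.2
    rw [Function.iterate_succ_apply', Function.iterate_succ_apply', ← ih.1]
    exact this

theorem Marks.iterate {w : Side × ℝ} {p : InvLim lam} (hp : Generic p) (h : Marks w p)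
    (hw : w ∈ neverGap lam) (k : ℕ) :
    Marks ((outsideMap lam)^[k] w) ((TentSphere.natExt lam)^[k] p) := by
  induction k with
  | zero => exact h
  | succ k ih =>
    rw [Function.iterate_succ_apply', Function.iterate_succ_apply']
    refine ih.natExt ?_ (hw.2 k)
    rw [← zpow_natExt_ofNat, generic_zpow]; exact hp

theorem mem_specialOrbit_iff {p : InvLim lam} (hp : Generic p) :
    p ∈ specialOrbit lam ↔ ∃ w ∈ neverGap lam, Marks w p := by
  constructor
  · rintro ⟨w, hw, h⟩
    have h0 : p.1 0 = w.2 := by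
      obtain ⟨side, x⟩ := w
      cases side <;> exact h.1
    exact ⟨w, hw, (isExtremeElt_iff (h0 ▸ hp)).1 h⟩
  · rintro ⟨w, hw, h⟩
    exact ⟨w, hw, (isExtremeElt_iff (h.1 ▸ hp)).2 h⟩

/-- Let the pair be shifted by `r`. For `r ≤ 0` the `B`-orbit of a mark in `Π` would reach the gap
after `-r` steps. For `r > 0` a member of the pair would be a proper backward iterate of an extreme
element at level 1, hence beyond `â`. -/
theorem Folded.notMem_specialOrbit {p p' : InvLim lam} (h : Folded p p') :
    p ∉ specialOrbit lam := by
  have hp := h.generic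
  rw [mem_specialOrbit_iff hp]
  rintro ⟨w, hw, hm⟩
  obtain ⟨r, q, q', hq, rfl, -⟩ := h
  obtain ⟨k, rfl | rfl⟩ := r.eq_nat_or_neg
  · rcases Nat.eq_zero_or_pos k with rfl | hk
    · simp only [Nat.cast_zero, zpow_zero, Equiv.Perm.one_apply] at hm
      have : w.1 = .upper := sideLevel_injective (hm.2.symm.trans hq.level_left)
      exact hw.2 0 ⟨this, hm.1 ▸ hq.leftEnd_lt, hm.1 ▸ hq.lt_hat⟩
    · rw [zpow_natExt_ofNat] at hm
      have e : shift^[k] ((natExt lam)^[k] q) = q :=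
        (Function.LeftInverse.iterate (g := shift) (f := natExt lam) shift_natExt k) q
      have h1 := hat_leftEnd_lt_of_level_eq_one hm.extreme hk (by rw [e]; exact hq.level_left)
      have h2 := hq.lt_hat
      have h3 := iterate_shift_val ((natExt lam)^[k] q) k 0
      rw [e, zero_add] at h3
      rw [← h3] at h1
      exact lt_asymm h1 h2
  · rw [zpow_natExt_neg_ofNat] at hm hp
    have := hm.iterate hp hw k
    rw [iterate_natExt_shift] at this
    have h1 : ((outsideMap lam)^[k] w).1 = .upper :=
      sideLevel_injective (this.2.symm.trans hq.level_left)
    exact hw.2 k ⟨h1, this.1 ▸ hq.leftEnd_lt, this.1 ▸ hq.lt_hat⟩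

/-- A generic fiber contains at most one element of `e(Π)`. -/
theorem eq_of_mem_specialOrbit {p p' : InvLim lam} (hp : Generic p) (h0 : p.1 0 = p'.1 0)
    (h : p ∈ specialOrbit lam) (h' : p' ∈ specialOrbit lam) : p = p' := by
  have hp' : Generic p' := by unfold Generic; rwa [← h0]
  obtain ⟨w, hw, hm⟩ := (mem_specialOrbit_iff hp).1 h
  obtain ⟨w', hw', hm'⟩ := (mem_specialOrbit_iff hp').1 h'
  -- If `x_u` and `x_ℓ` both lie in `Π`, then `x > â > c`, so `B(x_ℓ) = f(x)_u` lies in `Π` and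
  -- `f(x) > â`. But `f(x) < f(a) < â`.
  have key : ∀ x : ℝ, (Side.upper, x) ∈ neverGap lam → (Side.lower, x) ∈ neverGap lam →
      x ∉ grandOrbit lam → False := by
    intro x hu hl hx
    have up : ∀ z : ℝ, z ∉ grandOrbit lam → (Side.upper, z) ∈ neverGap lam →
        hat (leftEnd lam) < z := by
      intro z hz hzw
      by_contra H
      have n1 : leftEnd lam ≠ z := fun e => hz (e ▸ leftEnd_mem_grandOrbit lam)
      have n2 : z ≠ hat (leftEnd lam) := fun e => hz
        (e ▸ hat_mem_grandOrbit (hat_leftEnd_mem_core lam) (leftEnd_mem_grandOrbit lam))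
      exact hzw.2 0 ⟨rfl, lt_of_le_of_ne hzw.1.1 n1, lt_of_le_of_ne (not_lt.1 H) n2⟩
    have h1 := up x hx hu
    have h2 := (outsideMap_mem_neverGap hl).2
    rw [outsideMap, if_neg (not_le.2 ((crit_lt_hat_leftEnd lam).trans h1))] at h2
    have h3 := up _ (by rwa [tent_mem_grandOrbit_iff hl.1]) h2
    exact lt_asymm h3 ((tent_lt_of_hat_lt h1).trans (tent_leftEnd_lt lam))
  obtain ⟨side, x⟩ := w
  obtain ⟨side', x'⟩ := w'
  obtain rfl : x = x' := hm.1.symm.trans (h0.trans hm'.1)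
  have hx : x ∉ grandOrbit lam := fun hx => hp (by rw [hm.1]; exact hx)
  cases side <;> cases side'
  · exact hm.eq hp hm'
  · exact (key x hw' hw hx).elim
  · exact (key x hw hw' hx).elim
  · exact hm.eq hp hm'

/-! ### The set `Π` for rational height -/

theorem coe_unitAddCircle_eq_iff {s t : ℝ} :
    (s : UnitAddCircle) = (t : UnitAddCircle) ↔ ∃ N : ℤ, t = s + N := by
  rw [QuotientAddGroup.eq, AddSubgroup.mem_zmultiples_iff]
  refine exists_congr fun N => ?_
  rw [zsmul_eq_mul, mul_one]
  constructor <;> intro h <;> linarith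

theorem two_mul_core_length (lam : Slope) :
    2 * (rightEnd lam - leftEnd lam) = (lam : ℝ) * ((lam : ℝ) - 1) := by
  rw [leftEnd_eq, rightEnd_eq]; ring

/-- An explicit lift of the outside map. -/
noncomputable def stdLift (lam : Slope) (t : ℝ) : ℝ :=
  ⌊t⌋ + ((lam : ℝ) - 1) * leftEnd lam / ((lam : ℝ) * ((lam : ℝ) - 1)) +
    min ((lam : ℝ) * Int.fract t) 1

theorem continuous_stdLift (lam : Slope) : Continuous (stdLift lam) := by
  have hc : Continuous ((fun u : ℝ => min ((lam : ℝ) * u) 1 - u) ∘ Int.fract) :=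
    ContinuousOn.comp_fract'' (by fun_prop) (by simp [(one_lt lam).le])
  have hFe : stdLift lam = fun t =>
      t + ((lam : ℝ) - 1) * leftEnd lam / ((lam : ℝ) * ((lam : ℝ) - 1)) +
        ((fun u : ℝ => min ((lam : ℝ) * u) 1 - u) ∘ Int.fract) t := by
    funext t
    simp only [Function.comp, stdLift]
    linarith [Int.floor_add_fract t]
  rw [hFe]
  fun_prop

theorem stdLift_add_int (t : ℝ) (N : ℤ) : stdLift lam (t + N) = stdLift lam t + N := by
  unfold stdLift
  rw [Int.floor_add_intCast, Int.fract_add_intCast]; push_cast; ring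

theorem stdLift_of_mem {t : ℝ} (h0 : 0 ≤ t) (h1 : t ≤ 1) : stdLift lam t =
    ((lam : ℝ) - 1) * leftEnd lam / ((lam : ℝ) * ((lam : ℝ) - 1)) + min ((lam : ℝ) * t) 1 := by
  unfold stdLift
  rcases h1.lt_or_eq with h1 | rfl
  · rw [Int.floor_eq_zero_iff.2 ⟨h0, h1⟩, Int.fract_eq_self.2 ⟨h0, h1⟩]; simp
  · rw [Int.floor_one, Int.fract_one, mul_one, min_eq_right (one_lt lam).le]; simp; ring

theorem core_ratio_mem {x : ℝ} (hx : x ∈ core lam) :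
    (x - leftEnd lam) / (2 * (rightEnd lam - leftEnd lam)) ∈ Icc (0 : ℝ) (1 / 2) := by
  have h : leftEnd lam < rightEnd lam := (leftEnd_lt_crit lam).trans (crit_lt_rightEnd lam)
  refine ⟨div_nonneg (by linarith [hx.1]) (by linarith), ?_⟩
  rw [div_le_iff₀ (by linarith)]; linarith [hx.2]

theorem circleCoord_mem {w : Side × ℝ} (hw : w.2 ∈ core lam) :
    circleCoord lam w ∈ Icc (0 : ℝ) 1 := by
  obtain ⟨side, x⟩ := w
  obtain ⟨h0, h1⟩ := core_ratio_mem hw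
  cases side <;> simp only [circleCoord] at * <;> constructor <;> linarith

theorem stdLift_circleCoord {w : Side × ℝ} (hw : w.2 ∈ core lam) :
    ((stdLift lam (circleCoord lam w) : ℝ) : UnitAddCircle) =
      (circleCoord lam (outsideMap lam w) : ℝ) := by
  have hmem := circleCoord_mem hw
  rw [stdLift_of_mem hmem.1 hmem.2, coe_unitAddCircle_eq_iff]
  obtain ⟨side, x⟩ := w
  obtain ⟨hx1, hx2⟩ := hw
  simp only at hx1 hx2
  have h1 := one_lt lam
  have h2 := slope_lt_two lam
  have ha := leftEnd_eq lam
  have hd : ∀ w, (w - leftEnd lam) / (2 * (rightEnd lam - leftEnd lam)) =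
      (w - leftEnd lam) / (lam * ((lam : ℝ) - 1)) := fun w => by rw [two_mul_core_length]
  have hb := rightEnd_eq lam
  set l : ℝ := (lam : ℝ) with hl
  have hne : l ≠ 0 := by linarith
  have hne' : l - 1 ≠ 0 := by linarith
  have hll : 0 < l * (l - 1) := by nlinarith
  cases side with
  | lower =>
    simp only [outsideMap]
    simp only [circleCoord]
    have hmin : min (l * ((x - leftEnd lam) / (2 * (rightEnd lam - leftEnd lam)))) 1 =
        l * ((x - leftEnd lam) / (2 * (rightEnd lam - leftEnd lam))) := by
      have := (core_ratio_mem (x := x) ⟨hx1, hx2⟩).2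
      apply min_eq_left; nlinarith
    rw [hmin]
    refine ⟨0, ?_⟩
    split_ifs with hxc
    · dsimp only
      rw [tent_of_le hxc, hd, hd, ← hl]
      push_cast
      field_simp
      ring
    · dsimp only
      rw [tent_of_ge (not_le.1 hxc).le, hd, hd, ← hl, ha]
      push_cast
      field_simp
      ring
  | upper =>
    simp only [outsideMap]
    simp only [circleCoord]
    split_ifs with hxc
    · have hle : 1 - 1 / l ≤ (x - leftEnd lam) / (l * (l - 1)) := by
        rw [le_div_iff₀ hll]
        have : (1 - 1 / l) * (l * (l - 1)) = (l - 1) ^ 2 := by field_simp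
        rw [this]
        unfold hat at hxc
        nlinarith
      have hmin : min (l * (1 - (x - leftEnd lam) / (l * (l - 1)))) 1 =
          l * (1 - (x - leftEnd lam) / (l * (l - 1))) := by
        apply min_eq_left
        have : l * (1 / l) = 1 := by field_simp
        nlinarith
      -- The upper copy is sent across the base point `a`, so the lift exceeds the coordinate of the
      -- image by one full turn.
      refine ⟨-1, ?_⟩
      dsimp only
      rw [tent_of_ge ((crit_lt_hat_leftEnd lam).trans hxc).le, hd, hd, hmin, ← hl, ha]
      push_cast
      field_simp
      ring
    · have hle : (x - leftEnd lam) / (l * (l - 1)) ≤ 1 - 1 / l := by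
        rw [div_le_iff₀ hll]
        have : (1 - 1 / l) * (l * (l - 1)) = (l - 1) ^ 2 := by field_simp
        rw [this]
        unfold hat at hxc
        push Not at hxc
        nlinarith
      have hmin : min (l * (1 - (x - leftEnd lam) / (l * (l - 1)))) 1 = 1 := by
        apply min_eq_right
        have : l * (1 / l) = 1 := by field_simp
        nlinarith
      refine ⟨-1, ?_⟩
      dsimp only
      rw [tent_leftEnd, hd, hd, hmin, ← hl]
      push_cast
      field_simp
      ring

theorem exists_circleCoord_eq (lam : Slope) {t : ℝ} (h0 : 0 ≤ t) (h1 : t ≤ 1) :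
    ∃ w : Side × ℝ, w.2 ∈ core lam ∧ circleCoord lam w = t := by
  have h : leftEnd lam < rightEnd lam := (leftEnd_lt_crit lam).trans (crit_lt_rightEnd lam)
  have hne : rightEnd lam - leftEnd lam ≠ 0 := by linarith
  rcases le_total t (1 / 2) with ht | ht
  · refine ⟨(.lower, leftEnd lam + t * (2 * (rightEnd lam - leftEnd lam))), ⟨?_, ?_⟩, ?_⟩
    · simp only; nlinarith
    · simp only; nlinarith
    · simp only [circleCoord]; field_simp; ring
  · refine ⟨(.upper, leftEnd lam + (1 - t) * (2 * (rightEnd lam - leftEnd lam))), ⟨?_, ?_⟩, ?_⟩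
    · simp only; nlinarith
    · simp only; nlinarith
    · simp only [circleCoord]; field_simp; ring

/-- Two lifts of the outside map differ by an integer. -/
theorem IsOutsideLift.eq_stdLift_add {F : CircleDeg1Lift} (hF : IsOutsideLift lam F) :
    ∃ N : ℤ, ∀ t, F t = stdLift lam t + N := by
  have hint : ∀ t, ∃ N : ℤ, F t - stdLift lam t = N := by
    intro t
    obtain ⟨w, hw, e⟩ := exists_circleCoord_eq lam (Int.fract_nonneg t) (Int.fract_lt_one t).le
    have h1 := hF.2 w.1 w.2 hw
    rw [← stdLift_circleCoord (w := (w.1, w.2)) hw, coe_unitAddCircle_eq_iff] at h1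
    obtain ⟨N, hN⟩ := h1
    refine ⟨-N, ?_⟩
    have h2 : t = Int.fract t + ⌊t⌋ := (Int.fract_add_floor t).symm
    rw [h2, CircleDeg1Lift.map_add_int, stdLift_add_int, ← e]
    simp only [Prod.mk.eta] at hN
    rw [hN]; push_cast; ring
  have hcont : Continuous fun t => F t - stdLift lam t := hF.1.sub (continuous_stdLift lam)
  choose N hN using hint
  refine ⟨N 0, fun t => ?_⟩
  -- A continuous integer-valued function on the line is constant.
  have hNc : Continuous N := by
    rw [Int.isClosedEmbedding_coe_real.isEmbedding.continuous_iff]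
    exact hcont.congr fun t => hN t
  have := hN t
  rw [PreconnectedSpace.constant inferInstance hNc (x := t) (y := 0)] at this
  linarith

/-! ### Expansion off the gap and eventual periodicity. -/

/-- The gap lifts to the intervals where the fractional part exceeds `1 / λ`, each of length `1 - 1
/ λ`. Two closer points outside them lie in the same unit interval, on a single affine piece of
slope `λ`. -/
theorem expands_of_fract_le {F : CircleDeg1Lift} (hF : IsOutsideLift lam F) {u v : ℝ}
    (hu : Int.fract u ≤ 1 / lam) (hv : Int.fract v ≤ 1 / lam)
    (huv : |v - u| < 1 - 1 / lam) : |F v - F u| = lam * |v - u| := by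
  wlog h : u ≤ v generalizing u v
  · rw [abs_sub_comm, abs_sub_comm v]
    exact this hv hu (by rwa [abs_sub_comm]) (not_le.1 h).le
  obtain ⟨N, hN⟩ := hF.eq_stdLift_add
  have hl := one_lt lam
  have hl1 : (lam : ℝ) * (1 / lam) = 1 := by field_simp
  rw [abs_of_nonneg (sub_nonneg.2 h)] at huv
  have hfl : ⌊u⌋ = ⌊v⌋ := by
    refine le_antisymm (Int.floor_mono h) (not_lt.1 fun H => ?_)
    have H' : (⌊u⌋ : ℝ) + 1 ≤ ⌊v⌋ := by exact_mod_cast H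
    linarith [Int.floor_add_fract u, Int.floor_add_fract v, Int.fract_nonneg v]
  have e : F v - F u = lam * (v - u) := by
    rw [hN, hN]
    unfold stdLift
    rw [min_eq_left (by nlinarith), min_eq_left (by nlinarith), hfl]
    unfold Int.fract
    rw [hfl]; ring
  rw [e, abs_mul, abs_of_pos (by linarith : (0 : ℝ) < lam)]

theorem iterate_expands {F : CircleDeg1Lift} (hF : IsOutsideLift lam F) {u v : ℝ}
    (hu : ∀ i, Int.fract (F^[i] u) ≤ 1 / lam) (hv : ∀ i, Int.fract (F^[i] v) ≤ 1 / lam) {n : ℕ}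
    (huv : (lam : ℝ) ^ n * |v - u| < 1 - 1 / lam) :
    |F^[n] v - F^[n] u| = (lam : ℝ) ^ n * |v - u| := by
  induction n with
  | zero => simp
  | succ n ih =>
    have h1 := one_lt lam
    have h2 : (lam : ℝ) ^ n * |v - u| ≤ (lam : ℝ) ^ (n + 1) * |v - u| := by
      rw [pow_succ]
      have : 0 ≤ (lam : ℝ) ^ n * |v - u| := by positivity
      nlinarith
    have := ih (h2.trans_lt huv)
    rw [Function.iterate_succ_apply', Function.iterate_succ_apply',
      expands_of_fract_le hF (hu n) (hv n) (by rw [this]; exact h2.trans_lt huv), this, pow_succ]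
    ring

theorem tendsto_iterate_of_fixed {U : ℝ → ℝ} (hU : Monotone U) {t x y : ℝ} (hx : U x = x)
    (hy : U y = y) (hxt : x ≤ t) (hty : t ≤ y) :
    ∃ L, Filter.Tendsto (fun j => U^[j] t) Filter.atTop (𝓝 L) := by
  have hlow : ∀ j, x ≤ U^[j] t := fun j => by
    have := hU.iterate j hxt
    rwa [Function.iterate_fixed hx] at this
  have hup : ∀ j, U^[j] t ≤ y := fun j => by
    have := hU.iterate j hty
    rwa [Function.iterate_fixed hy] at this
  rcases le_total t (U t) with h | h
  · exact ⟨_, tendsto_atTop_ciSup (hU.monotone_iterate_of_le_map h)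
      ⟨y, by rintro _ ⟨j, rfl⟩; exact hup j⟩⟩
  · exact ⟨_, tendsto_atTop_ciInf (hU.antitone_iterate_of_map_le h)
      ⟨x, by rintro _ ⟨j, rfl⟩; exact hlow j⟩⟩

theorem iterate_map_add_int (F : CircleDeg1Lift) (i : ℕ) (t : ℝ) (N : ℤ) :
    F^[i] (t + N) = F^[i] t + N := by
  rw [← CircleDeg1Lift.coe_pow, CircleDeg1Lift.map_add_int]

/-- The monotone map `U = Fⁿ - m` has a fixed point, so all its orbits converge and consecutive
differences tend to 0. Off the gap small differences do not shrink, so eventually they vanish. -/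
theorem exists_iterate_eq {F : CircleDeg1Lift} (hF : IsOutsideLift lam F) {n : ℕ} {m : ℤ}
    {x t : ℝ} (hx : F^[n] x = x + m) (ht : ∀ i, Int.fract (F^[i] t) ≤ 1 / lam) :
    ∃ j : ℕ, F^[(j + 1) * n] t = F^[j * n] t + m := by
  have hl := one_lt lam
  set U : ℝ → ℝ := fun s => F^[n] s - m with hUdef
  have hU : Monotone U := fun a b hab => sub_le_sub_right (F.monotone.iterate n hab) _
  have hfix : ∀ M : ℤ, U (x + M) = x + M := fun M => by
    simp only [hUdef]; rw [iterate_map_add_int, hx]; ring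
  have hT : ∀ j, U^[j] t = F^[j * n] t - (j * m : ℤ) := by
    intro j
    induction j with
    | zero => simp
    | succ j ih =>
      rw [Function.iterate_succ_apply', ih]
      simp only [hUdef]
      have := iterate_map_add_int F n (F^[j * n] t) (-(j * m))
      rw [← Function.iterate_add_apply, Int.cast_neg, ← sub_eq_add_neg, ← sub_eq_add_neg] at this
      rw [this, show (j + 1) * n = n + j * n by ring]
      push_cast; ring
  -- Integer translates of `x` are fixed by `U`; two of them enclose `t`.
  obtain ⟨L, hL⟩ := tendsto_iterate_of_fixed (t := t) hU (hfix ⌊t - x⌋) (hfix ⌈t - x⌉)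
    (by linarith [Int.floor_le (t - x)]) (by linarith [Int.le_ceil (t - x)])
  set d : ℕ → ℝ := fun j => |U^[j + 1] t - U^[j] t| with hd
  have hd0 : Filter.Tendsto d Filter.atTop (𝓝 0) := by
    have := ((hL.comp (Filter.tendsto_add_atTop_nat 1)).sub hL).abs
    rwa [sub_self, abs_zero] at this
  have hQ : ∀ j i, Int.fract (F^[i] (U^[j] t)) ≤ 1 / lam := by
    intro j i
    rw [hT, sub_eq_add_neg, ← Int.cast_neg, iterate_map_add_int, Int.fract_add_intCast,
      ← Function.iterate_add_apply]
    exact ht _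
  have hgap : (0 : ℝ) < 1 - 1 / lam := by
    rw [sub_pos, div_lt_one (by linarith)]; exact hl
  have hpow : (1 : ℝ) ≤ (lam : ℝ) ^ n := one_le_pow₀ hl.le
  have hstep : ∀ j, (lam : ℝ) ^ n * d j < 1 - 1 / lam → d j ≤ d (j + 1) := by
    intro j hj
    have := iterate_expands hF (hQ j) (hQ (j + 1)) hj
    have e : d (j + 1) = |F^[n] (U^[j + 1] t) - F^[n] (U^[j] t)| := by
      simp only [hd]
      rw [Function.iterate_succ_apply' U (j + 1), Function.iterate_succ_apply' U j]
      simp only [hUdef]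
      congr 1; ring
    rw [e, this]
    have : 0 ≤ d j := abs_nonneg _
    change d j ≤ (lam : ℝ) ^ n * d j
    nlinarith
  obtain ⟨J, hJ⟩ := Filter.eventually_atTop.1
    ((hd0.const_mul ((lam : ℝ) ^ n)).eventually_lt_const (by rw [mul_zero]; exact hgap))
  have hmono : ∀ i, d J ≤ d (J + i) := by
    intro i
    induction i with
    | zero => exact le_rfl
    | succ i ih => exact ih.trans (hstep _ (hJ _ (by omega)))
  have hle : d J ≤ 0 := by
    refine ge_of_tendsto (hd0.comp (Filter.tendsto_add_atTop_nat J)) ?_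
    exact Filter.Eventually.of_forall fun i => by
      simp only [Function.comp]; rw [add_comm]; exact hmono i
  have hz : U^[J + 1] t = U^[J] t := sub_eq_zero.1 (abs_eq_zero.1 (le_antisymm hle (abs_nonneg _)))
  refine ⟨J, ?_⟩
  rw [hT, hT] at hz
  push_cast at hz
  linarith

/-- The endpoint `â_u` of the gap has coordinate `1 / λ`. The other endpoint, `a` on the upper copy,
has coordinate 1, whose fractional part is 0. -/
theorem fract_circleCoord_le {w : Side × ℝ} (hw : w.2 ∈ core lam) (hg : w ∉ gap lam) {t : ℝ}
    (ht : (t : UnitAddCircle) = (circleCoord lam w : ℝ)) : Int.fract t ≤ 1 / lam := by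
  obtain ⟨N, hN⟩ := coe_unitAddCircle_eq_iff.1 ht
  have e : Int.fract t = Int.fract (circleCoord lam w) := by rw [hN, Int.fract_add_intCast]
  rw [e]
  have h1 := one_lt lam
  have h2 := slope_lt_two lam
  obtain ⟨side, x⟩ := w
  obtain ⟨m0, m1⟩ := circleCoord_mem hw
  obtain ⟨r0, r1⟩ := core_ratio_mem hw
  have hhalf : (1 : ℝ) / 2 ≤ 1 / lam := by
    rw [div_le_div_iff₀ (by norm_num) (by linarith)]; linarith
  have hfr : circleCoord lam (side, x) ≤ 1 / lam →
      Int.fract (circleCoord lam (side, x)) ≤ 1 / lam := fun h => by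
    have : (1 : ℝ) / lam < 1 := by rw [div_lt_one (by linarith)]; exact h1
    rw [Int.fract_eq_self.2 ⟨m0, by linarith⟩]; exact h
  cases side with
  | lower => exact hfr (r1.trans hhalf)
  | upper =>
    rcases eq_or_lt_of_le hw.1 with e | e
    · simp only at e
      simp only [circleCoord, ← e, sub_self, zero_div, sub_zero, Int.fract_one]
      positivity
    · simp only at e
      have hx : hat (leftEnd lam) ≤ x := not_lt.1 fun H => hg ⟨rfl, e, H⟩
      refine hfr ?_
      have ha := leftEnd_eq lam
      have hll : (0 : ℝ) < lam * ((lam : ℝ) - 1) := by nlinarith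
      simp only [circleCoord]
      rw [two_mul_core_length, sub_le_comm, le_div_iff₀ hll]
      have : (1 - 1 / (lam : ℝ)) * (lam * ((lam : ℝ) - 1)) = ((lam : ℝ) - 1) ^ 2 := by field_simp
      rw [this]
      unfold hat at hx
      nlinarith

theorem iterate_circleCoord {F : CircleDeg1Lift} (hF : IsOutsideLift lam F) {w : Side × ℝ}
    (hw : w ∈ neverGap lam) (i : ℕ) : ((F^[i] (circleCoord lam w) : ℝ) : UnitAddCircle) =
      (circleCoord lam ((outsideMap lam)^[i] w) : ℝ) := by
  induction i with
  | zero => rfl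
  | succ i ih =>
    rw [Function.iterate_succ_apply', Function.iterate_succ_apply']
    obtain ⟨N, hN⟩ := coe_unitAddCircle_eq_iff.1 ih
    have h := hF.2 ((outsideMap lam)^[i] w).1 _ (iterate_outsideMap_mem_neverGap hw i).2.1
    simp only [Prod.mk.eta] at h
    rw [← h, hN, CircleDeg1Lift.map_add_int]
    exact coe_unitAddCircle_eq_iff.2 ⟨N, rfl⟩

theorem circleCoord_inj {w w' : Side × ℝ} (hw : w.2 ∈ core lam) (hw' : w'.2 ∈ core lam)
    (h : ((circleCoord lam w : ℝ) : UnitAddCircle) = (circleCoord lam w' : ℝ)) :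
    w.2 = w'.2 ∧ (w.2 ∈ Ioo (leftEnd lam) (rightEnd lam) → w = w') := by
  obtain ⟨N, hN⟩ := coe_unitAddCircle_eq_iff.1 h
  obtain ⟨s, x⟩ := w
  obtain ⟨s', x'⟩ := w'
  simp only at hw hw'
  obtain ⟨r0, r1⟩ := core_ratio_mem hw
  obtain ⟨r0', r1'⟩ := core_ratio_mem hw'
  have hlen : 0 < 2 * (rightEnd lam - leftEnd lam) := by
    linarith [leftEnd_lt_crit lam, crit_lt_rightEnd lam]
  have key : ∀ z z' : ℝ, (z - leftEnd lam) / (2 * (rightEnd lam - leftEnd lam)) =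
      (z' - leftEnd lam) / (2 * (rightEnd lam - leftEnd lam)) → z = z' := fun z z' e => by
    rw [div_left_inj' hlen.ne'] at e; linarith
  have hzero : ∀ z : ℝ, (z - leftEnd lam) / (2 * (rightEnd lam - leftEnd lam)) = 0 →
      z = leftEnd lam := fun z e => by
    rw [div_eq_zero_iff] at e
    rcases e with e | e <;> linarith
  have hhalf : ∀ z : ℝ, (z - leftEnd lam) / (2 * (rightEnd lam - leftEnd lam)) = 1 / 2 →
      z = rightEnd lam := fun z e => by
    rw [div_eq_iff hlen.ne'] at e; linarith
  set u := (x - leftEnd lam) / (2 * (rightEnd lam - leftEnd lam))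
  set u' := (x' - leftEnd lam) / (2 * (rightEnd lam - leftEnd lam))
  -- A lower and an upper point have the same class only at the glued endpoints `a` and `b`.
  have mixed : u + u' = 0 ∨ u + u' = 1 → x = x' ∧ ¬ x ∈ Ioo (leftEnd lam) (rightEnd lam) := by
    rintro (e | e)
    · rw [hzero x (by change u = 0; linarith), hzero x' (by change u' = 0; linarith)]
      exact ⟨rfl, fun h => lt_irrefl _ h.1⟩
    · rw [hhalf x (by change u = 1 / 2; linarith), hhalf x' (by change u' = 1 / 2; linarith)]
      exact ⟨rfl, fun h => lt_irrefl _ h.2⟩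
  have hNlt : ∀ {c : ℝ}, c < 1 → -1 < c → (N : ℝ) = c → N = 0 := fun hc hc' e => by
    have h1 : (N : ℝ) < 1 := e ▸ hc
    have h2 : (-1 : ℝ) < N := e ▸ hc'
    have h1' : N < 1 := by exact_mod_cast h1
    have h2' : -1 < N := by exact_mod_cast h2
    omega
  have hN01 : (N : ℝ) ≤ 1 → (-1 : ℝ) ≤ N → N = 0 ∨ N = 1 ∨ N = -1 := fun h1 h2 => by
    have h1' : N ≤ 1 := by exact_mod_cast h1
    have h2' : -1 ≤ N := by exact_mod_cast h2
    omega
  cases s <;> cases s' <;> simp only [circleCoord] at hN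
  · change u' = u + N at hN
    have := hNlt (c := u' - u) (by linarith) (by linarith) (by linarith)
    rw [this] at hN
    obtain rfl := key x x' (by change u = u'; simp at hN; exact hN.symm)
    exact ⟨rfl, fun _ => rfl⟩
  · change 1 - u' = u + N at hN
    have h3 : u + u' = 0 ∨ u + u' = 1 := by
      rcases hN01 (by linarith) (by linarith) with e | e | e <;> rw [e] at hN <;> push_cast at hN
      · right; linarith
      · left; linarith
      · linarith
    exact ⟨(mixed h3).1, fun h => absurd h (mixed h3).2⟩
  · change u' = 1 - u + N at hN
    have h3 : u + u' = 0 ∨ u + u' = 1 := by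
      rcases hN01 (by linarith) (by linarith) with e | e | e <;> rw [e] at hN <;> push_cast at hN
      · right; linarith
      · linarith
      · left; linarith
    exact ⟨(mixed h3).1, fun h => absurd h (mixed h3).2⟩
  · change 1 - u' = 1 - u + N at hN
    have := hNlt (c := u - u') (by linarith) (by linarith) (by linarith)
    rw [this] at hN
    obtain rfl := key x x' (by change u = u'; simp at hN; exact hN.symm)
    exact ⟨rfl, fun _ => rfl⟩

/-! ### Genericity, periodicity and finiteness of `e(Π)`. -/

theorem HasHeight.exists_lift {q : ℚ} (hq : HasHeight lam (q : ℝ)) :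
    ∃ F : CircleDeg1Lift, IsOutsideLift lam F ∧ ∃ (m : ℤ) (x : ℝ), F^[q.den] x = x + m := by
  obtain ⟨-, F, hF, h⟩ := hq
  obtain ⟨N, hN⟩ := coe_unitAddCircle_eq_iff.1 h
  -- The height fixes the translation number of the lift only modulo integers, hence the correction
  -- by `N`.
  refine ⟨F, hF, q.num - N * q.den, ?_⟩
  have hden : (q.den : ℝ) ≠ 0 := by exact_mod_cast q.den_ne_zero
  have e : F.translationNumber = ((q.num - N * q.den : ℤ) : ℝ) / (q.den : ℕ) := by
    have hq' : (q : ℝ) = q.num / q.den := Rat.cast_def q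
    rw [hq'] at hN
    push_cast
    field_simp at hN ⊢
    linarith
  obtain ⟨x, hx⟩ := (CircleDeg1Lift.translationNumber_eq_rat_iff F hF.1 q.den_pos).1 e
  exact ⟨x, by rw [← CircleDeg1Lift.coe_pow]; exact hx⟩

theorem HasHeight.exists_circleCoord_eq {q : ℚ} (hq : HasHeight lam (q : ℝ)) {w : Side × ℝ}
    (hw : w ∈ neverGap lam) : ∃ j : ℕ,
      ((circleCoord lam ((outsideMap lam)^[(j + 1) * q.den] w) : ℝ) : UnitAddCircle) =
        (circleCoord lam ((outsideMap lam)^[j * q.den] w) : ℝ) := by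
  obtain ⟨F, hF, m, x, hx⟩ := hq.exists_lift
  have ht : ∀ i, Int.fract (F^[i] (circleCoord lam w)) ≤ 1 / lam := fun i =>
    fract_circleCoord_le (iterate_outsideMap_mem_neverGap hw i).2.1 (hw.2 i)
      (iterate_circleCoord hF hw i)
  obtain ⟨j, hj⟩ := exists_iterate_eq hF hx ht
  refine ⟨j, ?_⟩
  rw [← iterate_circleCoord hF hw, ← iterate_circleCoord hF hw]
  exact (coe_unitAddCircle_eq_iff.2 ⟨m, hj⟩).symm

/-- Eventual periodicity under the outside map projects to eventual periodicity under `f`,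
impossible in the grand orbit of an infinite critical orbit. -/
theorem HasHeight.notMem_grandOrbit {q : ℚ} (hq : HasHeight lam (q : ℝ))
    (hinf : (postCritical lam).Infinite) {w : Side × ℝ} (hw : w ∈ neverGap lam) :
    w.2 ∉ grandOrbit lam := by
  obtain ⟨j, hj⟩ := hq.exists_circleCoord_eq hw
  have h1 := iterate_outsideMap_mem_neverGap hw ((j + 1) * q.den)
  have h2 := iterate_outsideMap_mem_neverGap hw (j * q.den)
  have := (circleCoord_inj h1.2.1 h2.2.1 hj).1
  rw [h1.1, h2.1] at this
  exact notMem_grandOrbit_of_eventually_periodic hinf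
    (Nat.mul_lt_mul_of_pos_right (Nat.lt_succ_self j) q.den_pos) this.symm

theorem HasHeight.generic_of_mem {q : ℚ} (hq : HasHeight lam (q : ℝ))
    (hinf : (postCritical lam).Infinite) {p : InvLim lam} (hp : p ∈ specialOrbit lam) :
    Generic p := by
  obtain ⟨⟨side, x⟩, hw, h⟩ := hp
  have h0 : p.1 0 = x := by cases side <;> exact h.1
  unfold Generic
  rw [h0]
  exact hq.notMem_grandOrbit hinf hw

theorem HasHeight.iterate_natExt_eq {q : ℚ} (hq : HasHeight lam (q : ℝ))
    (hinf : (postCritical lam).Infinite) {p : InvLim lam} (hp : p ∈ specialOrbit lam) :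
    (natExt lam)^[q.den] p = p := by
  have gp := hq.generic_of_mem hinf hp
  obtain ⟨w, hw, hm⟩ := (mem_specialOrbit_iff gp).1 hp
  obtain ⟨j, hj⟩ := hq.exists_circleCoord_eq hw
  have h1 := iterate_outsideMap_mem_neverGap hw ((j + 1) * q.den)
  have h2 := iterate_outsideMap_mem_neverGap hw (j * q.den)
  have m1 := hm.iterate gp hw ((j + 1) * q.den)
  have m2 := hm.iterate gp hw (j * q.den)
  have g1 : Generic ((natExt lam)^[(j + 1) * q.den] p) := by
    rw [← zpow_natExt_ofNat, generic_zpow]; exact gp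
  -- Genericity excludes the glued endpoints, so equality on the circle also gives equality of
  -- sides.
  have e := (circleCoord_inj h1.2.1 h2.2.1 hj).2 (by
    rw [← m1.1]
    refine ⟨g1.leftEnd_lt 0, lt_of_le_of_ne (((natExt lam)^[(j + 1) * q.den] p).2.1 0).2 fun h => g1.val_notMem 0 ?_⟩
    rw [h]; exact rightEnd_mem_grandOrbit lam)
  rw [e] at m1
  have := m1.eq g1 m2
  rw [show (j + 1) * q.den = j * q.den + q.den by ring, Function.iterate_add_apply] at this
  -- Since `f̂` is injective, eventual periodicity is periodicity.
  exact (natExt lam).injective.iterate _ this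

/-- Equal digits over one period give `|x₀ - x₀'| = λⁿ |xₙ - xₙ'|`, and periodicity turns the right
side into `λⁿ |x₀ - x₀'|`. Thus a point of period `n` is determined by `n` digits, which yields the
finiteness of `e(Π)`. -/
theorem eq_of_periodic {n : ℕ} (hn : 0 < n) {p p' : InvLim lam} (hp : (natExt lam)^[n] p = p)
    (hp' : (natExt lam)^[n] p' = p') (h : ∀ i < n, itin p i = itin p' i) : p = p' := by
  have per : ∀ u : InvLim lam, (natExt lam)^[n] u = u → ∀ i, u.1 (i + n) = u.1 i := by
    intro u hu i
    have e : shift^[n] u = u := by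
      conv_lhs => rw [← hu]
      exact (Function.LeftInverse.iterate (g := shift) (f := natExt lam) shift_natExt n) u
    rw [← iterate_shift_val, e]
  have hd : ∀ i < n, |p.1 i - p'.1 i| = lam * |p.1 (i + 1) - p'.1 (i + 1)| := by
    intro i hi
    have hl := one_lt lam
    have hh := (itin_eq_iff i).1 (h i hi)
    rw [← p.2.2 i, ← p'.2.2 i]
    have habs : |(lam : ℝ)| = lam := abs_of_pos (by linarith)
    rcases le_or_gt (p.1 (i + 1)) crit with hc | hc
    · rw [tent_of_le hc, tent_of_le (hh.1 hc), ← mul_sub, abs_mul, habs]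
    · have hc' : crit < p'.1 (i + 1) := not_le.1 fun H => absurd (hh.2 H) (not_le.2 hc)
      rw [tent_of_ge hc.le, tent_of_ge hc'.le, ← mul_sub, abs_mul, habs, abs_sub_comm]
      congr 2; ring
  have hpow : ∀ i ≤ n, |p.1 0 - p'.1 0| = (lam : ℝ) ^ i * |p.1 i - p'.1 i| := by
    intro i
    induction i with
    | zero => simp
    | succ i ih =>
      intro hi
      rw [ih (by omega), hd i (by omega), pow_succ]; ring
  have h0 : p.1 0 = p'.1 0 := by
    have e := hpow n le_rfl
    have e1 := per p hp 0
    have e2 := per p' hp' 0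
    rw [zero_add] at e1 e2
    rw [e1, e2] at e
    have : (1 : ℝ) < (lam : ℝ) ^ n := one_lt_pow₀ (one_lt lam) hn.ne'
    have : |p.1 0 - p'.1 0| = 0 := by nlinarith [abs_nonneg (p.1 0 - p'.1 0)]
    exact sub_eq_zero.1 (abs_eq_zero.1 this)
  have hv := val_eq_of_itin_eq h0 h
  refine val_ext fun r => ?_
  induction r using Nat.strong_induction_on with
  | _ r ih =>
    rcases Nat.lt_or_ge n r with hr | hr
    · obtain ⟨d, rfl⟩ := Nat.exists_eq_add_of_le' hr.le
      rw [per p hp, per p' hp']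
      exact ih d (by omega)
    · exact hv r hr

theorem HasHeight.finite_specialOrbit {q : ℚ} (hq : HasHeight lam (q : ℝ))
    (hinf : (postCritical lam).Infinite) : (specialOrbit lam).Finite := by
  refine Set.Finite.of_finite_image (f := fun (p : InvLim lam) (i : Fin q.den) => itin p i)
    (Set.toFinite _) fun p hp p' hp' h => ?_
  exact eq_of_periodic q.den_pos (hq.iterate_natExt_eq hinf hp) (hq.iterate_natExt_eq hinf hp')
    fun i hi => congrFun h ⟨i, hi⟩

/-! ### The equivalence relation on generic points -/

theorem natExt_congr {p p' : InvLim lam} (h0 : p.1 0 = p'.1 0) (h : level p = level p') :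
    (natExt lam p).1 0 = (natExt lam p').1 0 ∧ level (natExt lam p) = level (natExt lam p') := by
  have e : (natExt lam p).1 0 = (natExt lam p').1 0 := by
    rw [natExt_val_zero, natExt_val_zero, h0]
  obtain ⟨e1, e2⟩ := affine_congr e
    (by rw [natExt_val_succ, natExt_val_succ, h0] : (natExt lam p).1 (0 + 1) ≤ crit ↔ _)
  refine ⟨e, ?_⟩
  rw [level_eq (natExt lam p), level_eq (natExt lam p'), e1, e2, shift_natExt, shift_natExt, h]

/-- Two tails of level 1 on opposite branches meet at level `1 / 2 = 1 - 1 / 2`. -/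
theorem FoldPair.natExt_congr {q q' : InvLim lam} (h : FoldPair q q') :
    (natExt lam q).1 0 = (natExt lam q').1 0 ∧ level (natExt lam q) = level (natExt lam q') := by
  have e : (natExt lam q).1 0 = (natExt lam q').1 0 := by
    rw [natExt_val_zero, natExt_val_zero, h.val_eq, tent_hat]
  refine ⟨e, ?_⟩
  have key : ∀ u u' : InvLim lam, FoldPair u u' → u.1 0 < crit →
      level (natExt lam u) = level (natExt lam u') := by
    intro u u' hu hlt
    have h1 : (natExt lam u).1 1 ≤ crit := hlt.le
    have h2 : crit < (natExt lam u').1 1 := by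
      change crit < u'.1 0
      rw [hu.val_eq]; unfold hat crit at *; linarith
    have h0 : (natExt lam u').1 0 = (natExt lam u).1 0 := by
      rw [natExt_val_zero, natExt_val_zero, hu.val_eq, tent_hat]
    rw [level_of_le_crit h1, level_of_crit_lt (h0 ▸ tent_leftEnd_le_of_le_crit h1) h2,
      shift_natExt, shift_natExt, hu.level_left, hu.level_right]
    norm_num
  rcases lt_or_gt_of_ne (h.generic.val_ne_crit 0) with hc | hc
  · exact key q q' h hc
  · refine (key q' q h.symm ?_).symm
    rw [h.val_eq]; unfold hat crit at *; linarith

theorem Folded.cases {p p' : InvLim lam} (h : Folded p p') :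
    (p.1 0 = p'.1 0 ∧ level p = level p') ∨
      (p.1 0 ≠ p'.1 0 ∧ (level p = 0 ∨ level p = 1)) := by
  obtain ⟨r, q, q', hq, rfl, rfl⟩ := h
  have neg : ∀ k : ℕ, (shift^[k] q).1 0 ≠ (shift^[k] q').1 0 ∧
      (level (shift^[k] q) = 0 ∨ level (shift^[k] q) = 1) := by
    refine fun k => ⟨fun e => ?_, level_iterate_shift_of_extreme (Or.inr hq.level_left) k⟩
    have e1 := iterate_natExt_val_zero (shift^[k] q) k
    have e2 := iterate_natExt_val_zero (shift^[k] q') k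
    rw [iterate_natExt_shift] at e1 e2
    have h1 := e1.trans ((congrArg _ e).trans e2.symm)
    rw [hq.val_eq] at h1
    apply hq.generic.val_ne_crit 0
    unfold hat crit at *; linarith
  obtain ⟨k, rfl | rfl⟩ := r.eq_nat_or_neg
  · rcases k with _ | k
    · exact Or.inr (neg 0)
    · left
      rw [zpow_natExt_ofNat, zpow_natExt_ofNat]
      induction k with
      | zero => exact hq.natExt_congr
      | succ k ih =>
        rw [Function.iterate_succ_apply', Function.iterate_succ_apply' _ _ q']
        exact TentSphere.natExt_congr ih.1 ih.2
  · right
    rw [zpow_natExt_neg_ofNat, zpow_natExt_neg_ofNat]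
    exact neg k

/-- An explicit equivalence relation which contains the one defining `Σ` and has the same classes
of generic points. -/
def CoarseRel (p p' : InvLim lam) : Prop :=
  p = p' ∨ (¬ Generic p ∧ ¬ Generic p') ∨ (p ∈ specialOrbit lam ∧ p' ∈ specialOrbit lam) ∨
    Folded p p'

theorem CoarseRel.symm {p p' : InvLim lam} (h : CoarseRel p p') : CoarseRel p' p := by
  rcases h with h | h | h | h
  · exact Or.inl h.symm
  · exact Or.inr (Or.inl h.symm)
  · exact Or.inr (Or.inr (Or.inl h.symm))
  · exact Or.inr (Or.inr (Or.inr h.symm))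

/-- Non-generic points, `e(Π)` and folded points are pairwise disjoint, and partners are unique, so
no chain mixes two kinds of identification. -/
theorem CoarseRel.trans (hs : ∀ p ∈ specialOrbit lam, Generic p) {p p' p'' : InvLim lam}
    (h : CoarseRel p p') (h' : CoarseRel p' p'') : CoarseRel p p'' := by
  rcases h with rfl | h | h | h
  · exact h'
  · rcases h' with rfl | h' | h' | h'
    · exact Or.inr (Or.inl h)
    · exact Or.inr (Or.inl ⟨h.1, h'.2⟩)
    · exact absurd (hs _ h'.1) h.2
    · exact absurd h'.generic h.2
  · rcases h' with rfl | h' | h' | h'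
    · exact Or.inr (Or.inr (Or.inl h))
    · exact absurd (hs _ h.2) h'.1
    · exact Or.inr (Or.inr (Or.inl ⟨h.1, h'.2⟩))
    · exact absurd h.2 h'.notMem_specialOrbit
  · rcases h' with rfl | h' | h' | h'
    · exact Or.inr (Or.inr (Or.inr h))
    · exact absurd h.symm.generic h'.1
    · exact absurd h'.1 h.symm.notMem_specialOrbit
    · exact Or.inl (h.symm.right_unique h')

theorem IsExtremeElt.val_eq {side : Side} {x : ℝ} {p : InvLim lam} (h : IsExtremeElt side x p) :
    p.1 0 = x := by
  cases side <;> exact h.1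

/-- The points `a`, `â`, `ẑ` are in the grand orbit, so type 2 is entirely non-generic. A class of
type 1 is either non-generic throughout or made of a shifted fold pair. -/
theorem coarseRel_of_mem {n : ℕ} {C : Set (InvLim lam)} (hC : C ∈ identClasses lam n)
    {p p' : InvLim lam} (hp : p ∈ C) (hp' : p' ∈ C) : CoarseRel p p' := by
  rcases hC with ⟨x, hx, -, -, r, rfl⟩ | ⟨r, rfl⟩ | rfl
  · obtain ⟨u, hu, rfl⟩ := hp
    obtain ⟨v, hv, rfl⟩ := hp'
    have hxc : x ∈ core lam := ⟨hx.1.le, (hx.2.trans (crit_lt_rightEnd lam)).le⟩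
    have hxc' : hat x ∈ core lam := by
      have h1 := hx.1
      have h2 := hx.2
      have h3 := leftEnd_lt_crit lam
      refine ⟨?_, le_trans ?_ (hat_leftEnd_mem_core lam).2⟩ <;> unfold hat crit at * <;> linarith
    by_cases hg : x ∈ grandOrbit lam
    · have key : ∀ w : InvLim lam, (IsExtremeElt .upper x w ∨ IsExtremeElt .upper (hat x) w) →
          ¬ Generic w := by
        rintro w (hw | hw) gw
        · exact gw (by rw [hw.val_eq]; exact hg)
        · exact gw (by rw [hw.val_eq]; exact hat_mem_grandOrbit hxc' hg)
      exact Or.inr (Or.inl ⟨(generic_zpow r).not.2 (key u hu), (generic_zpow r).not.2 (key v hv)⟩)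
    · have hg' : hat x ∉ grandOrbit lam := fun h => hg ((hat_mem_grandOrbit_iff hxc hxc').1 h)
      have fold : ∀ w w' : InvLim lam, IsExtremeElt .upper x w →
          IsExtremeElt .upper (hat x) w' → FoldPair w w' := by
        intro w w' hw hw'
        obtain ⟨a1, a2⟩ := (isExtremeElt_iff hg).1 hw
        obtain ⟨b1, b2⟩ := (isExtremeElt_iff hg').1 hw'
        exact ⟨by unfold Generic; rwa [a1], a2, b2, a1 ▸ hx.1,
          a1 ▸ hx.2.trans (crit_lt_hat_leftEnd lam), by rw [b1, a1]⟩
      have same : ∀ (z : ℝ) (w w' : InvLim lam), z ∉ grandOrbit lam → IsExtremeElt .upper z w →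
          IsExtremeElt .upper z w' → w = w' := by
        intro z w w' hz hw hw'
        obtain ⟨a1, a2⟩ := (isExtremeElt_iff hz).1 hw
        obtain ⟨b1, b2⟩ := (isExtremeElt_iff hz).1 hw'
        exact eq_of_level_eq (by unfold Generic; rwa [a1]) (a1.trans b1.symm) (a2.trans b2.symm)
          (Or.inr a2)
      rcases hu with hu | hu <;> rcases hv with hv | hv
      · exact Or.inl (by rw [same x u v hg hu hv])
      · exact Or.inr (Or.inr (Or.inr ⟨r, u, v, fold u v hu hv, rfl, rfl⟩))
      · exact Or.inr (Or.inr (Or.inr ⟨r, u, v, (fold v u hv hu).symm, rfl, rfl⟩))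
      · exact Or.inl (by rw [same _ u v hg' hu hv])
  · have key : ∀ w ∈ classII lam n r, ¬ Generic w := by
      rintro w (⟨u, hu, rfl⟩ | ⟨u, hu, rfl⟩) gw <;> rw [generic_zpow] at gw <;> apply gw
      · have hz : hat (zPt lam n) ∈ core lam := hu.val_eq ▸ u.2.1 0
        rw [hu.val_eq]
        exact hat_mem_grandOrbit hz
          ((iterate_mem_grandOrbit_iff (leftEnd_mem_core lam) n).2 (leftEnd_mem_grandOrbit lam))
      · rcases hu with hu | hu <;> rw [hu.val_eq]
        · exact leftEnd_mem_grandOrbit lam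
        · exact hat_mem_grandOrbit (hat_leftEnd_mem_core lam) (leftEnd_mem_grandOrbit lam)
    exact Or.inr (Or.inl ⟨key p hp, key p' hp'⟩)
  · exact Or.inr (Or.inr (Or.inl ⟨hp, hp'⟩))

theorem coarseRel_of_gMap_eq (hs : ∀ p ∈ specialOrbit lam, Generic p) {n : ℕ}
    {p p' : InvLim lam} (h : gMap lam n p = gMap lam n p') : CoarseRel p p' := by
  have h' : Relation.EqvGen (fun p p' => ∃ C ∈ identClasses lam n, p ∈ C ∧ p' ∈ C) p p' :=
    Quotient.exact h
  clear h
  induction h' with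
  | rel p p' h =>
    obtain ⟨C, hC, h1, h2⟩ := h
    exact coarseRel_of_mem hC h1 h2
  | refl p => exact Or.inl rfl
  | symm p p' _ ih => exact ih.symm
  | trans p p' p'' _ _ ih ih' => exact ih.trans hs ih'

theorem Folded.gMap_eq {p p' : InvLim lam} (h : Folded p p') (n : ℕ) :
    gMap lam n p = gMap lam n p' := by
  have key : ∀ (r : ℤ) (q q' : InvLim lam), FoldPair q q' → q.1 0 < crit →
      gMap lam n ((natExt lam ^ r) q) = gMap lam n ((natExt lam ^ r) q') := by
    intro r q q' hq hlt
    have hz : zPt lam n ∈ grandOrbit lam :=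
      (iterate_mem_grandOrbit_iff (leftEnd_mem_core lam) n).2 (leftEnd_mem_grandOrbit lam)
    refine Quotient.sound (Relation.EqvGen.rel _ _ ⟨classI lam (q.1 0) r, Or.inl ⟨q.1 0,
      ⟨hq.leftEnd_lt, hlt⟩, fun e => hq.generic (e ▸ hz), fun e => hq.generic ?_, r, rfl⟩,
      ⟨q, Or.inl ((isExtremeElt_iff hq.generic).2 ⟨rfl, hq.level_left⟩), rfl⟩,
      ⟨q', Or.inr ((isExtremeElt_iff ?_).2 ⟨hq.val_eq, hq.level_right⟩), rfl⟩⟩)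
    · rw [e]
      exact hat_mem_grandOrbit (e ▸ q.2.1 0) hz
    · rw [← hq.val_eq]; exact hq.generic_right
  obtain ⟨r, q, q', hq, rfl, rfl⟩ := h
  rcases lt_or_gt_of_ne (hq.generic.val_ne_crit 0) with hc | hc
  · exact key r q q' hq hc
  · refine (key r q' q hq.symm ?_).symm
    rw [hq.val_eq]; unfold hat crit at *; linarith

theorem gMap_eq_iff (hs : ∀ p ∈ specialOrbit lam, Generic p) {n : ℕ} {p p' : InvLim lam}
    (hp : Generic p) (h0 : p.1 0 = p'.1 0) :
    gMap lam n p = gMap lam n p' ↔ level p = level p' := by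
  constructor
  · intro h
    rcases coarseRel_of_gMap_eq hs h with rfl | h | h | h
    · rfl
    · exact absurd hp h.1
    · rw [eq_of_mem_specialOrbit hp h0 h.1 h.2]
    · rcases h.cases with h | h
      · exact h.2
      · exact absurd h0 h.1
  · intro h
    by_cases hne : p = p'
    · rw [hne]
    obtain ⟨k, h1, h2⟩ := exists_first_difference h0 hne
    obtain ⟨e1, e2, -⟩ := level_eq_aux k p p' hp h1 h2 h
    refine Folded.gMap_eq ⟨(k + 1 : ℕ), shift^[k + 1] p, shift^[k + 1] p', ?_, ?_, ?_⟩ n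
    · have gp' : Generic p' := by unfold Generic; rwa [← h0]
      have hv := val_hat_of_ne (h1 k le_rfl) h2
      refine ⟨(generic_iterate_shift _).2 hp, e1, e2, ?_, ?_, ?_⟩
      · rw [iterate_shift_val]; exact hp.leftEnd_lt _
      · have := gp'.leftEnd_lt (k + 1)
        rw [hv] at this
        rw [iterate_shift_val, zero_add]
        unfold hat at *; linarith
      · rw [iterate_shift_val, iterate_shift_val, zero_add, hv]
    · rw [zpow_natExt_ofNat, iterate_natExt_shift]
    · rw [zpow_natExt_ofNat, iterate_natExt_shift]

/-! ### Topology of generic fibers and of their images -/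

theorem continuous_val (r : ℕ) : Continuous fun p : InvLim lam => p.1 r :=
  (continuous_apply r).comp
    (continuous_subtype_val :
      Continuous (fun p : {x : ℕ → ℝ // (∀ r, x r ∈ core lam) ∧ ∀ r, tent lam (x (r + 1)) = x r} =>
        p.1))

instance (lam : Slope) : T2Space (InvLim lam) :=
  inferInstanceAs (T2Space
    {x : ℕ → ℝ // (∀ r, x r ∈ core lam) ∧ ∀ r, tent lam (x (r + 1)) = x r})

theorem continuous_tent (lam : Slope) : Continuous (tent lam) := by
  unfold tent; fun_prop

instance (lam : Slope) : CompactSpace (InvLim lam) := by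
  have hK : IsCompact {x : ℕ → ℝ | (∀ r, x r ∈ core lam) ∧ ∀ r, tent lam (x (r + 1)) = x r} := by
    refine (isCompact_univ_pi (s := fun _ : ℕ => core lam) fun _ => isCompact_Icc).of_isClosed_subset
      ?_ fun x hx r _ => hx.1 r
    simp only [ofPred_and, ofPred_forall]
    refine (isClosed_iInter fun r => isClosed_Icc.preimage (continuous_apply r)).inter
      (isClosed_iInter fun r => isClosed_eq ((continuous_tent lam).comp (continuous_apply _))
        (continuous_apply r))
  exact isCompact_iff_compactSpace.1 hK

theorem isClosed_fiber (lam : Slope) (y : ℝ) : IsClosed (fiber lam y) :=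
  isClosed_singleton.preimage (continuous_val 0)

/-- No coordinate of a generic point equals `c`, so each digit is locally constant, and finitely
many digits control the level. -/
theorem continuousOn_level {y : ℝ} (hy : y ∉ grandOrbit lam) :
    ContinuousOn (level (lam := lam)) (fiber lam y) := by
  intro p hp
  have hp0 : p.1 0 = y := hp
  have gp : Generic p := by unfold Generic; rwa [hp0]
  refine Metric.continuousWithinAt_iff'.2 fun ε hε => ?_
  obtain ⟨N, hN⟩ := exists_pow_lt_of_lt_one (by positivity : 0 < ε / 2)
    (by norm_num : (3 / 4 : ℝ) < 1)
  have hev : ∀ᶠ p' in 𝓝 p, ∀ i ∈ Finset.range N, (p'.1 (i + 1) ≤ crit ↔ p.1 (i + 1) ≤ crit) := by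
    refine (Filter.eventually_all_finset _).2 fun i _ => ?_
    have hc := (continuous_val (lam := lam) (i + 1)).tendsto p
    rcases lt_or_gt_of_ne (gp.val_ne_crit (i + 1)) with h | h
    · filter_upwards [hc.eventually_lt_const h] with p' hp'
      exact ⟨fun _ => h.le, fun _ => hp'.le⟩
    · filter_upwards [hc.eventually_const_lt h] with p' hp'
      exact ⟨fun h' => absurd h' (not_le.2 hp'), fun h' => absurd h' (not_le.2 h)⟩
  filter_upwards [mem_nhdsWithin_of_mem_nhds hev, self_mem_nhdsWithin] with p' h1 h2
  rw [Real.dist_eq]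
  have h20 : p'.1 0 = y := h2
  refine (abs_level_sub_le N (h20.trans hp0.symm)
    fun i hi => h1 i (Finset.mem_range.2 hi)).trans_lt ?_
  linarith

theorem isQuotientMap_gMap (lam : Slope) (n : ℕ) : IsQuotientMap (gMap lam n) :=
  isQuotientMap_quot_mk

/-- A point identified with a point of `K` either lies in the fiber at the same level, hence in `K`,
or belongs to `e(Π)`, or is the partner of one of the at most two extreme elements. The saturation
is `K` plus a finite set. -/
theorem isClosed_saturation (hs : ∀ p ∈ specialOrbit lam, Generic p)
    (hfin : (specialOrbit lam).Finite) {y : ℝ} (hy : y ∉ grandOrbit lam) (n : ℕ) {A : Set ℝ}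
    (hA : IsClosed A) :
    IsClosed (gMap lam n ⁻¹' (gMap lam n '' (fiber lam y ∩ level ⁻¹' A))) := by
  set K := fiber lam y ∩ level ⁻¹' A with hK
  set S := gMap lam n ⁻¹' (gMap lam n '' K)
  have gen : ∀ p ∈ fiber lam y, Generic p := fun p (hp : p.1 0 = y) => by
    unfold Generic; rwa [hp]
  set E : Set (InvLim lam) := {q | q ∈ fiber lam y ∧ (level q = 0 ∨ level q = 1)}
  have hE : E.Finite := by
    refine Set.Finite.of_finite_image (f := level)
      (((Set.finite_singleton (1 : ℝ)).insert 0).subset ?_) ?_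
    · rintro _ ⟨q, hq, rfl⟩
      exact hq.2
    · intro q hq q' hq' h
      exact eq_of_level_eq (gen q hq.1)
        ((show q.1 0 = y from hq.1).trans (show q'.1 0 = y from hq'.1).symm) h hq.2
  set T : Set (InvLim lam) := specialOrbit lam ∪ ⋃ q ∈ E, {p | Folded q p}
  have hT : T.Finite := hfin.union (hE.biUnion fun q _ =>
    Set.Subsingleton.finite fun p hp p' hp' => hp.right_unique hp')
  have hS : S = K ∪ (S ∩ T) := by
    refine Set.Subset.antisymm ?_ (union_subset (subset_preimage_image _ _) inter_subset_left)
    intro p hp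
    obtain ⟨q, hq, hqp⟩ := hp
    have gq := gen q hq.1
    rcases coarseRel_of_gMap_eq hs hqp with rfl | h | h | h
    · exact Or.inl hq
    · exact absurd gq h.1
    · exact Or.inr ⟨⟨q, hq, hqp⟩, Or.inl h.2⟩
    · rcases h.cases with h' | h'
      · left
        refine ⟨h'.1.symm.trans hq.1, ?_⟩
        have := hq.2
        simp only [mem_preimage] at this ⊢
        rwa [← h'.2]
      · exact Or.inr ⟨⟨q, hq, hqp⟩, Or.inr (mem_biUnion (x := q) ⟨hq.1, h'.2⟩ h)⟩
  rw [hS]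
  exact ((continuousOn_level hy).preimage_isClosed_of_isClosed (isClosed_fiber lam y) hA).union
    (hT.subset inter_subset_right).isClosed

theorem isArc_image_fiber (hs : ∀ p ∈ specialOrbit lam, Generic p)
    (hfin : (specialOrbit lam).Finite) {y : ℝ} (hyc : y ∈ core lam) (hy : y ∉ grandOrbit lam)
    (n : ℕ) : IsArc (gMap lam n '' fiber lam y) := by
  choose P hP0 hPl using fun t : unitInterval => exists_level_eq hyc hy t.2
  have eqv : ∀ p p' : InvLim lam, p.1 0 = y → p'.1 0 = y →
      (gMap lam n p = gMap lam n p' ↔ level p = level p') := fun p p' h h' =>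
    gMap_eq_iff hs (by unfold Generic; rwa [h]) (h.trans h'.symm)
  set ψ : unitInterval → Sig lam n := fun t => gMap lam n (P t)
  have hψ : ∀ p : InvLim lam, p.1 0 = y → ψ ⟨level p, level_mem_Icc p⟩ = gMap lam n p :=
    fun p h => (eqv _ _ (hP0 _) h).2 (hPl _)
  have hinj : Function.Injective ψ := fun t t' h => by
    have := (eqv _ _ (hP0 t) (hP0 t')).1 h
    rw [hPl, hPl] at this
    exact Subtype.ext this
  have hcont : Continuous ψ := by
    -- The choice of `P t` need not be continuous. Instead, preimages of closed sets are images
    -- under `level` of compact subsets of the fiber.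
    refine continuous_iff_isClosed.2 fun C hC => ?_
    have hc : IsCompact (fiber lam y ∩ gMap lam n ⁻¹' C) :=
      ((isClosed_fiber lam y).inter (hC.preimage (isQuotientMap_gMap lam n).continuous)).isCompact
    have he : ψ ⁻¹' C = Subtype.val ⁻¹' (level '' (fiber lam y ∩ gMap lam n ⁻¹' C)) := by
      ext t
      constructor
      · exact fun h => ⟨P t, ⟨hP0 t, h⟩, hPl t⟩
      · rintro ⟨q, ⟨hq, hqC⟩, hl⟩
        have : gMap lam n (P t) = gMap lam n q := (eqv _ _ (hP0 t) hq).2 ((hPl t).trans hl.symm)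
        change gMap lam n (P t) ∈ C
        rw [this]; exact hqC
    rw [he]
    exact (hc.image_of_continuousOn
      ((continuousOn_level hy).mono inter_subset_left)).isClosed.preimage continuous_subtype_val
  have hclosed : IsClosedMap ψ := by
    intro A hA
    have he : ψ '' A = gMap lam n '' (fiber lam y ∩ level ⁻¹' (Subtype.val '' A)) := by
      ext σ
      constructor
      · rintro ⟨t, ht, rfl⟩
        exact ⟨P t, ⟨hP0 t, t, ht, (hPl t).symm⟩, rfl⟩
      · rintro ⟨q, ⟨hq, t, ht, hl⟩, rfl⟩
        exact ⟨t, ht, (eqv _ _ (hP0 t) hq).2 ((hPl t).trans hl)⟩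
    rw [he, ← (isQuotientMap_gMap lam n).isClosed_preimage]
    exact isClosed_saturation hs hfin hy n
      ((isClosed_Icc.isClosedEmbedding_subtypeVal).isClosedMap A hA)
  have hrange : range ψ = gMap lam n '' fiber lam y := by
    ext σ
    constructor
    · rintro ⟨t, rfl⟩
      exact ⟨P t, hP0 t, rfl⟩
    · rintro ⟨q, hq, rfl⟩
      exact ⟨_, hψ q hq⟩
  rw [← hrange]
  exact ⟨(IsClosedEmbedding.of_continuous_injective_isClosedMap hcont hinj
    hclosed).isEmbedding.toHomeomorph⟩

end TentSphere

theorem mainTheorem5 (lam : Slope) (hinf : (postCritical lam).Infinite)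
    (q : ℚ) (hq : HasHeight lam (q : ℝ))
    (y : ℝ) (hy : y ∈ core lam) (hyc : y ∉ grandOrbit lam) :
    IsArc (gMap lam q.den '' fiber lam y) ∧
    (∀ p ∈ fiber lam y, ∀ p' ∈ fiber lam y, p ≠ p' →
      (gMap lam q.den p = gMap lam q.den p' ↔
        (∀ side, ¬ IsExtremeElt side y p) ∧ (∀ side, ¬ IsExtremeElt side y p') ∧
          Consecutive y p p')) ∧
    (∃ pu pl : InvLim lam, IsExtremeElt .upper y pu ∧ IsExtremeElt .lower y pl ∧
      gMap lam q.den pu ≠ gMap lam q.den pl) := by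
  have hs : ∀ p ∈ specialOrbit lam, Generic p := fun p hp => hq.generic_of_mem hinf hp
  refine ⟨isArc_image_fiber hs (hq.finite_specialOrbit hinf) hy hyc _, ?_, ?_⟩
  · intro p hp p' hp' hne
    have h0 : p.1 0 = y := hp
    have h0' : p'.1 0 = y := hp'
    have gp : Generic p := by unfold Generic; rwa [h0]
    rw [gMap_eq_iff hs gp (h0.trans h0'.symm), consecutive_iff hyc h0 h0' hne]
    refine ⟨fun h => ?_, fun h => h.2.2⟩
    -- Non-extremeness comes for free: a level shared by two points lies strictly between 0 and 1.
    have hIoo := level_mem_Ioo_of_eq gp (h0.trans h0'.symm) hne h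
    have key : ∀ u : InvLim lam, level u ∈ Ioo (0 : ℝ) 1 → ∀ side, ¬ IsExtremeElt side y u := by
      intro u hu side hx
      have hl := ((isExtremeElt_iff hyc).1 hx).2
      rcases sideLevel_mem side with e | e <;> rw [e] at hl
      · exact hu.1.ne' hl
      · exact hu.2.ne hl
    exact ⟨key p hIoo, key p' (h ▸ hIoo), h⟩
  · obtain ⟨pu, hu0, hu1⟩ := exists_level_eq hy hyc (t := 1) ⟨zero_le_one, le_rfl⟩
    obtain ⟨pl, hl0, hl1⟩ := exists_level_eq hy hyc (t := 0) ⟨le_rfl, zero_le_one⟩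
    refine ⟨pu, pl, (isExtremeElt_iff hyc).2 ⟨hu0, hu1⟩, (isExtremeElt_iff hyc).2 ⟨hl0, hl1⟩, ?_⟩
    rw [Ne, gMap_eq_iff hs (by unfold Generic; rwa [hu0]) (hu0.trans hl0.symm), hu1, hl1]
    exact one_ne_zero
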